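/- Let $m\in\frac12\mathbb N=\{\frac12,1,\frac32,\dots\}$ and let $n,\nu$ be integers with $0\le n<2m$ and $0\le\nu\le 2m$. For $\tau\in\mathbb C$ with $\operatorname{Im}\tau>0$, $z\in\mathbb C$ and $c\in\mathbb R$ write $q^c=e^{2\pi i\tau c}$, and put $$\theta_{k,\mu}^{(\pm)}(\tau,z)=\sum_{j\in\mathbb Z}(\pm1)^j e^{2\pi i\mu(j+\frac{k}{2\mu})z}q^{\mu(j+\frac{k}{2\mu})^2},\qquad \theta_{k,\mu}=\theta^{(+)}_{k,\mu},$$ $$g^{[m]}_{n,\nu}(\tau)=\Big[\sum_{\substack{j,p\in\mathbb Z\\0<p\le j}}-\sum_{\substack{j,p\in\mathbb Z\\ j<p\le0}}\Big](-1)^j q^{(m+\frac12)\left(j+\nu-\frac{\nu+1/2}{2m+1}\right)^2-m\left(p+\nu-\frac{n}{2m}\right)^2},$$ $$h^{[m]}_{n,\nu}(\tau,z)=\sum_{j\in\mathbb Z}\frac{e^{2\pi imjz+\pi inz}\,q^{mj^2+n(j+\nu)}}{1-e^{2\pi imz}q^{2m(j+\nu)}},$$ $$G^{[m]}_{n,\nu}(\tau,z)=g^{[m]}_{n,\nu}(\tau)\,\theta_{n,m}(\tau,z)+(-1)^\nu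 q^{-m\nu^2}\,\theta^{(-)}_{\nu+\frac12,m+\frac12}(\tau,0)\,h^{[m]}_{n,\nu}(\tau,z).$$ All these series converge absolutely for $mz\notin\mathbb Z+2m\tau\mathbb Z$, which is where $G^{[m]}_{n,\nu}(\tau,z)$ is defined. Moreover: 1) ($S$-transformation) For all $z$ with $mz\notin\mathbb Z+\tau\mathbb Z$ (so that every function below is defined), $$G^{[m]}_{n,\nu}\Big(-\frac1\tau,\frac z\tau\Big)=\frac{i(-i\tau)^{3/2}}{2m\sqrt{2m+1}}\sum_{n'=0}^{2m-1}\sum_{\nu'=0}^{2m}\sum_{\ell=0}^{2m-1}(-1)^{\nu+\nu'}e^{\frac{\pi in\ell}{m}}e^{-\frac{\pi i}{m+1/2}(\nu+\frac12)(\nu'+\frac12)}e^{\frac{\pi im}{2\tau}z^2}e^{-\pi i\ell z}q^{\frac{\ell^2}{4m}}\,G^{[m]}_{n',\nu'}\Big(\tau,z-\frac{\ell\tau}{m}\Big),$$ where $(-i\tau)^{3/2}$ is the principal branch. The sum over $0\le\ell<2m$ may be replaced by the sum over $\ell\in\mathbb Z/2m\mathbb Z$, that is, over any system of representatives in $\mathbb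 Z$ of the classes modulo $2m$. 2) ($T$-transformation) If $m\in\mathbb N$, then for all $z$ with $mz\notin\mathbb Z+2m\tau\mathbb Z$, $$G^{[m]}_{n,\nu}(\tau+1,z)=e^{\frac{\pi i}{2(m+1/2)}(\nu+\frac12)^2}\,G^{[m]}_{n,\nu}(\tau,z).$$ -/

import Mathlib

noncomputable section

namespace IndefiniteModular

/-- The power `q ^ c` of `q = e^{2πiτ}`, that is `e^{2πiτc}`. -/
def qPow (τ : ℂ) (c : ℝ) : ℂ :=
  Complex.exp (2 * Real.pi * Complex.I * τ * c)

/-- The `j`-th term `(±1)^j e^{2πim(j+k/2m)z} q^{m(j+k/2m)^2}` of the theta series of index `k`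
and degree `m`, with `ε = ±1`. -/
def thetaTerm (ε : ℂ) (k m : ℝ) (τ z : ℂ) (j : ℤ) : ℂ :=
  ε ^ j * Complex.exp (2 * Real.pi * Complex.I * m * ((j : ℂ) + k / (2 * m)) * z)
    * qPow τ (m * ((j : ℝ) + k / (2 * m)) ^ 2)

/-- Jacobi's theta function `θ_{k,m}(τ,z)`. -/
def thetaPlus (k m : ℝ) (τ z : ℂ) : ℂ := ∑' j : ℤ, thetaTerm 1 k m τ z j

/-- Jacobi's theta function `θ^{(-)}_{k,m}(τ,z)`. -/
def thetaMinus (k m : ℝ) (τ z : ℂ) : ℂ := ∑' j : ℤ, thetaTerm (-1) k m τ z j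

/-- The positive cone `0 < p ≤ j` of pairs `(j, p)`. -/
def conePos : Set (ℤ × ℤ) := {x | 0 < x.2 ∧ x.2 ≤ x.1}

/-- The negative cone `j < p ≤ 0` of pairs `(j, p)`. -/
def coneNeg : Set (ℤ × ℤ) := {x | x.1 < x.2 ∧ x.2 ≤ 0}

/-- The term of index `(j, p)` in the indefinite theta series `g^{[m]}_{n,ν}(τ)`. -/
def gTerm (m : ℝ) (n ν : ℕ) (τ : ℂ) (x : ℤ × ℤ) : ℂ :=
  (-1 : ℂ) ^ x.1
    * qPow τ ((m + 1 / 2) * ((x.1 : ℝ) + ν - ((ν : ℝ) + 1 / 2) / (2 * (m + 1 / 2))) ^ 2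
        - m * ((x.2 : ℝ) + ν - n / (2 * m)) ^ 2)

/-- The function `g^{[m]}_{n,ν}(τ)`. -/
def g (m : ℝ) (n ν : ℕ) (τ : ℂ) : ℂ :=
  (∑' x : conePos, gTerm m n ν τ x) - ∑' x : coneNeg, gTerm m n ν τ x

/-- The `j`-th term of the series `h^{[m]}_{n,ν}(τ,z)`. -/
def hTerm (m : ℝ) (n ν : ℕ) (τ z : ℂ) (j : ℤ) : ℂ :=
  Complex.exp (2 * Real.pi * Complex.I * m * j * z + Real.pi * Complex.I * n * z)
      * qPow τ (m * (j : ℝ) ^ 2 + n * ((j : ℝ) + ν))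
    / (1 - Complex.exp (2 * Real.pi * Complex.I * m * z) * qPow τ (2 * m * ((j : ℝ) + ν)))

/-- The function `h^{[m]}_{n,ν}(τ,z)`. -/
def h (m : ℝ) (n ν : ℕ) (τ z : ℂ) : ℂ := ∑' j : ℤ, hTerm m n ν τ z j

/-- The function `G^{[m]}_{n,ν}(τ,z)`. -/
def G (m : ℝ) (n ν : ℕ) (τ z : ℂ) : ℂ :=
  g m n ν τ * thetaPlus n m τ z
    + (-1) ^ ν * qPow τ (-m * (ν : ℝ) ^ 2)
      * thetaMinus ((ν : ℝ) + 1 / 2) (m + 1 / 2) τ 0 * h m n ν τ z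

/-- The summand of index `(n', ν', ℓ)` in the `S`-transformation of `G^{[m]}_{n,ν}`. -/
def sTerm (m : ℝ) (n ν : ℕ) (τ z : ℂ) (n' ν' : ℕ) (l : ℤ) : ℂ :=
  (-1) ^ (ν + ν')
    * Complex.exp (Real.pi * Complex.I * n * l / m)
    * Complex.exp (-(Real.pi * Complex.I / (m + 1 / 2) * (ν + 1 / 2) * (ν' + 1 / 2)))
    * Complex.exp (Real.pi * Complex.I * m / (2 * τ) * z ^ 2)
    * Complex.exp (-(Real.pi * Complex.I * l * z))
    * qPow τ ((l : ℝ) ^ 2 / (4 * m))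
    * G m n' ν' τ (z - l * τ / m)

end IndefiniteModular

end

noncomputable section

namespace IndefiniteModular

open Complex Filter Topology

/-! Write M = 2m. The Appell-type sums A_N = q^{-mN²} h_{n,N}, for N in ℤ, have consecutive
differences θ_{n,m}(τ,z) q^{-m(N+1-n/2m)²} (`appell_succ`). Telescoping from N = ν shows that the
two summands of G belong to a single series Σ_j w_j A_{j+ν}, where the w_j are, up to the sign
(-1)^ν, the terms of θ^{(-)}_{ν+1/2,m+1/2}(τ,0) (`G_eq_tsum_appell`). In w_j q^{-m(j+ν)²} the
indefinite part cancels, so the sums can be interchanged. Partial fractions of x^n/(1-x^M) over the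
M-th roots of unity turn the inner sum into values of Σ_J (-1)^J q^{J(J+1)/2}/(1-e^{πiu}q^J),
essentially the reciprocal of the odd theta function, and the outer sum becomes a theta series of
degree m+1/2. The outcome (`G_eq_sum_psi`) is G_{n,ν}(τ,z) = (-1)^ν/M Σ_{l mod M} e^{-2πinl/M}
Ψ_ν(τ, z+2l/M), with Ψ_ν (`psi`) the product of that theta series and `invTheta`.

Both factors are modular: the theta series by Poisson summation (`thetaMinus_S`), and `invTheta`
because its quasi-periods and its residue at 0 determine it, by a Liouville argument
(`eq_zero_of_quasiPeriodic`, `invTheta_S`). Fourier inversion in n (`psi_eq_sum_G`) then rewrites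
the transformed Ψ in terms of the functions G. The T-transformation multiplies every Ψ_ν by a
constant when M is even. -/

/-! ### Powers of q and Gaussian sums -/

lemma qPow_add (τ : ℂ) (a b : ℝ) : qPow τ (a + b) = qPow τ a * qPow τ b := by
  simp only [qPow, ← Complex.exp_add]
  congr 1
  push_cast
  ring

lemma norm_qPow (τ : ℂ) (c : ℝ) : ‖qPow τ c‖ = Real.exp (-(2 * Real.pi * τ.im * c)) := by
  rw [qPow, Complex.norm_exp]
  congr 1
  simp

lemma qPow_add_one (τ : ℂ) (c : ℝ) :
    qPow (τ + 1) c = qPow τ c * cexp (2 * Real.pi * I * c) := by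
  simp only [qPow, ← Complex.exp_add]
  congr 1
  ring

lemma qPow_add_one_of_int (τ : ℂ) (c : ℝ) (k : ℤ) (hc : c = k) : qPow (τ + 1) c = qPow τ c := by
  rw [qPow_add_one, hc]
  have : cexp (2 * Real.pi * I * ((k : ℝ) : ℂ)) = 1 := by
    rw [Complex.exp_eq_one_iff]
    exact ⟨k, by push_cast; ring⟩
  rw [this, mul_one]

/-- Up to e^C these are the norms of Jacobi theta terms at purely imaginary arguments. -/
lemma summable_exp_quadratic {A : ℝ} (hA : 0 < A) (B C : ℝ) :
    Summable fun j : ℤ => Real.exp (-(A * (j : ℝ) ^ 2) + B * j + C) := by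
  have h1 : Summable fun j : ℤ =>
      jacobiTheta₂_term j (((-B / (2 * Real.pi) : ℝ) : ℂ) * I) (((A / Real.pi : ℝ) : ℂ) * I) := by
    rw [summable_jacobiTheta₂_term_iff]
    simp only [Complex.mul_im, Complex.ofReal_re, Complex.ofReal_im, Complex.I_re, Complex.I_im]
    have := Real.pi_pos
    have : 0 < A / Real.pi := by positivity
    linarith
  refine (h1.norm.mul_left (Real.exp C)).congr fun j => ?_
  rw [norm_jacobiTheta₂_term, ← Real.exp_add]
  congr 1
  simp only [Complex.mul_im, Complex.ofReal_re, Complex.ofReal_im, Complex.I_re, Complex.I_im]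
  have := Real.pi_ne_zero
  field_simp
  ring

/-! ### The kernel x^n/(1-x^M): bounds and partial fractions -/

/-- The point `e^{πiu} q^j`. -/
def nomePt (τ u : ℂ) (j : ℤ) : ℂ := cexp (Real.pi * I * (u + 2 * j * τ))

lemma nomePt_add (τ u : ℂ) (j k : ℤ) : nomePt τ u (j + k) = nomePt τ (u + 2 * k * τ) j := by
  simp only [nomePt]
  congr 1
  push_cast
  ring

lemma norm_nomePt (τ u : ℂ) (j : ℤ) :
    ‖nomePt τ u j‖ = Real.exp (-(Real.pi * (u.im + 2 * j * τ.im))) := by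
  rw [nomePt, Complex.norm_exp]
  congr 1
  simp

lemma nomePt_eq (τ u : ℂ) (j : ℤ) : nomePt τ u j = cexp (Real.pi * I * u) * qPow τ j := by
  simp only [nomePt, qPow, ← Complex.exp_add]
  congr 1
  push_cast
  ring

/-- The rational function `x^n / (1 - x^M)`. -/
def geomKernel (n M : ℕ) (x : ℂ) : ℂ := x ^ n / (1 - x ^ M)

/-- As n < M, the kernel stays bounded at infinity as well as at 0; only the neighbourhood of the
unit circle is dangerous. -/
lemma norm_geomKernel_le_two {n M : ℕ} (hn : n < M) {x : ℂ} (hx : ‖x‖ ≤ 1 / 2 ∨ 2 ≤ ‖x‖) :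
    ‖geomKernel n M x‖ ≤ 2 := by
  rw [geomKernel, norm_div, norm_pow]
  have hx0 := norm_nonneg x
  rcases hx with hx | hx
  · have h1 : ‖x‖ ^ n ≤ 1 := pow_le_one₀ hx0 (by linarith)
    have h2 : ‖x‖ ^ M ≤ 1 / 2 :=
      (pow_le_of_le_one hx0 (by linarith) (by omega : M ≠ 0)).trans hx
    have h3 : 1 / 2 ≤ ‖1 - x ^ M‖ := by
      have := norm_sub_norm_le (1 : ℂ) (x ^ M)
      rw [norm_one, norm_pow] at this
      linarith
    rw [div_le_iff₀ (by linarith)]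
    linarith
  · have h1 : ‖x‖ ^ n ≤ ‖x‖ ^ M := pow_le_pow_right₀ (by linarith) hn.le
    have h2 : 2 ≤ ‖x‖ ^ M := hx.trans (le_self_pow₀ (by linarith) (by omega : M ≠ 0))
    have h3 : ‖x‖ ^ M - 1 ≤ ‖1 - x ^ M‖ := by
      have := norm_sub_norm_le (x ^ M) (1 : ℂ)
      rw [norm_one, norm_pow, norm_sub_rev] at this
      linarith
    rw [div_le_iff₀ (by linarith)]
    linarith

lemma exists_nomePt_far {τ : ℂ} (hτ : 0 < τ.im) (B : ℝ) :
    ∃ K : ℕ, ∀ u : ℂ, |u.im| ≤ B → ∀ j : ℤ, (K : ℤ) < |j| →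
      ‖nomePt τ u j‖ ≤ 1 / 2 ∨ 2 ≤ ‖nomePt τ u j‖ := by
  -- This K makes |Im u + 2j Im τ| ≥ 1 for |j| > K, so the modulus is at most e^{-π} or at least
  -- e^π; the estimate e ≥ 2 suffices.
  obtain ⟨K, hK⟩ := exists_nat_ge ((B + 1) / (2 * τ.im))
  rw [div_le_iff₀ (by positivity)] at hK
  refine ⟨K, fun u hu j hj => ?_⟩
  have hpi : (1 : ℝ) ≤ Real.pi := by linarith [Real.pi_gt_three]
  have he : (2 : ℝ) ≤ Real.exp 1 := by linarith [Real.add_one_le_exp (1 : ℝ)]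
  rw [abs_le] at hu
  rw [norm_nomePt]
  rcases lt_abs.mp hj with hj | hj
  · left
    have hj' : (K : ℝ) ≤ j := by exact_mod_cast hj.le
    have h1 : 1 ≤ u.im + 2 * j * τ.im := by nlinarith
    calc Real.exp (-(Real.pi * (u.im + 2 * j * τ.im))) ≤ Real.exp (-1) := by
          apply Real.exp_le_exp.mpr
          nlinarith
      _ ≤ 1 / 2 := by
          rw [Real.exp_neg, one_div]
          exact inv_anti₀ (by norm_num) he
  · right
    have hj' : (K : ℝ) ≤ -j := by exact_mod_cast hj.le
    have h1 : u.im + 2 * j * τ.im ≤ -1 := by nlinarith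
    refine he.trans (Real.exp_le_exp.mpr ?_)
    nlinarith

/-- Only finitely many points lie near the unit circle, and at a pole the kernel takes the default
value 0, so poles need not be excluded. -/
lemma exists_geomKernel_bound {τ : ℂ} (hτ : 0 < τ.im) (u : ℂ) {n M : ℕ} (hn : n < M) :
    ∃ C : ℝ, 0 ≤ C ∧ ∀ j : ℤ, ‖geomKernel n M (nomePt τ u j)‖ ≤ C := by
  obtain ⟨K, hK⟩ := exists_nomePt_far hτ |u.im|
  set S : Finset ℤ := Finset.Icc (-(K : ℤ)) K with hS
  have hS0 : 0 ≤ ∑ j ∈ S, ‖geomKernel n M (nomePt τ u j)‖ :=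
    Finset.sum_nonneg fun _ _ => norm_nonneg _
  refine ⟨2 + ∑ j ∈ S, ‖geomKernel n M (nomePt τ u j)‖, by positivity, fun j => ?_⟩
  by_cases hj : j ∈ S
  · have := Finset.single_le_sum (f := fun j => ‖geomKernel n M (nomePt τ u j)‖)
      (fun _ _ => norm_nonneg _) hj
    linarith
  · have : (K : ℤ) < |j| := by
      rw [hS, Finset.mem_Icc, ← abs_le] at hj
      exact not_le.mp hj
    linarith [norm_geomKernel_le_two hn (hK u le_rfl j this)]

/-- The root of unity `e^{2πil/M}`. -/
def rootPow (M : ℕ) (l : ℤ) : ℂ := cexp (2 * Real.pi * I * l / M)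

lemma rootPow_eq_zpow (M : ℕ) (l : ℤ) : rootPow M l = cexp (2 * Real.pi * I / M) ^ l := by
  rw [← Complex.exp_int_mul, rootPow]
  congr 1
  ring

lemma sum_rootPow_mul {M : ℕ} (hM : 0 < M) (k : ℤ) :
    ∑ l ∈ Finset.range M, rootPow M (k * l) = if (M : ℤ) ∣ k then (M : ℂ) else 0 := by
  have hprim := Complex.isPrimitiveRoot_exp M hM.ne'
  set ζ := cexp (2 * Real.pi * I / M) with hζ
  have h1 : ∀ l ∈ Finset.range M, rootPow M (k * l) = (ζ ^ k) ^ l := fun l _ => by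
    rw [rootPow_eq_zpow, zpow_mul, zpow_natCast]
  rw [Finset.sum_congr rfl h1]
  split_ifs with hk
  · rw [(hprim.zpow_eq_one_iff_dvd k).mpr hk]
    simp
  · have hne : ζ ^ k ≠ 1 := fun h => hk ((hprim.zpow_eq_one_iff_dvd k).mp h)
    have hpow : (ζ ^ k) ^ M = 1 := by
      rw [← zpow_natCast, ← zpow_mul, mul_comm, zpow_mul, zpow_natCast, hprim.pow_eq_one, one_zpow]
    rw [geom_sum_eq hne, hpow, sub_self, zero_div]

/-- Each 1/(1-ζ^l x) is a finite geometric sum over 1-x^M, and orthogonality of the characters l ↦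
ζ^{il} selects i = n. -/
lemma geomKernel_eq_sum {n M : ℕ} (hn : n < M) {x : ℂ} (hx : x ^ M ≠ 1) :
    geomKernel n M x
      = 1 / M * ∑ l ∈ Finset.range M, rootPow M (-(n * l)) * (1 - rootPow M l * x)⁻¹ := by
  have hM : 0 < M := by omega
  have hM0 : (M : ℂ) ≠ 0 := by exact_mod_cast hM.ne'
  have hD : (1 - x ^ M) ≠ 0 := sub_ne_zero.mpr hx.symm
  have hadd (a b : ℤ) : rootPow M (a + b) = rootPow M a * rootPow M b := by
    simp only [rootPow, ← Complex.exp_add]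
    congr 1
    push_cast
    ring
  have hpow (l i : ℕ) : rootPow M l ^ i = rootPow M (i * l) := by
    simp only [rootPow, ← Complex.exp_nat_mul]
    congr 1
    push_cast
    ring
  have hrM (l : ℕ) : rootPow M l ^ M = 1 := by
    rw [hpow, rootPow, Complex.exp_eq_one_iff]
    exact ⟨l, by push_cast; field_simp⟩
  have h1 (l : ℕ) : (1 - rootPow M l * x)⁻¹
      = ∑ i ∈ Finset.range M, rootPow M (i * l) * x ^ i / (1 - x ^ M) := by
    have h2 := mul_neg_geom_sum (rootPow M l * x) M
    rw [mul_pow, hrM, one_mul] at h2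
    have h3 : 1 - rootPow M l * x ≠ 0 := fun h => hD (by rw [← h2, h, zero_mul])
    rw [← Finset.sum_div, eq_div_iff hD, inv_mul_eq_iff_eq_mul₀ h3, ← h2]
    congr 1
    exact Finset.sum_congr rfl fun i _ => by rw [mul_pow, hpow]
  have h4 : ∑ l ∈ Finset.range M, rootPow M (-(n * l)) * (1 - rootPow M l * x)⁻¹
      = ∑ i ∈ Finset.range M, (∑ l ∈ Finset.range M, rootPow M (((i : ℤ) - n) * l))
          * (x ^ i / (1 - x ^ M)) := by
    simp_rw [h1, Finset.mul_sum, Finset.sum_mul]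
    rw [Finset.sum_comm]
    refine Finset.sum_congr rfl fun i _ => Finset.sum_congr rfl fun l _ => ?_
    have : ((i : ℤ) - n) * l = -(n * l) + i * l := by ring
    rw [this, hadd]
    ring
  rw [h4, Finset.sum_eq_single_of_mem n (Finset.mem_range.mpr hn)]
  · rw [sum_rootPow_mul hM, if_pos (by simp), geomKernel]
    field_simp
  · intro i hi hin
    rw [sum_rootPow_mul hM, if_neg, zero_mul]
    intro hdvd
    rw [Finset.mem_range] at hi
    have h0 := Int.eq_zero_of_abs_lt_dvd hdvd (by rw [abs_lt]; omega)
    omega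

/-! ### The lattice 2ℤ + 2τℤ -/

/-- Membership in the lattice `2ℤ + 2τℤ`. -/
def InLattice (τ u : ℂ) : Prop := ∃ a b : ℤ, u = a * 2 + b * (2 * τ)

lemma inLattice_add_iff {τ v : ℂ} (hv : InLattice τ v) (u : ℂ) :
    InLattice τ (u + v) ↔ InLattice τ u := by
  obtain ⟨a, b, rfl⟩ := hv
  constructor
  · rintro ⟨c, d, h⟩
    exact ⟨c - a, d - b, by push_cast; linear_combination h⟩
  · rintro ⟨c, d, rfl⟩
    exact ⟨c + a, d + b, by push_cast; ring⟩

lemma inLattice_two (τ : ℂ) : InLattice τ 2 := ⟨1, 0, by simp⟩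

lemma inLattice_two_mul (τ : ℂ) : InLattice τ (2 * τ) := ⟨0, 1, by simp⟩

lemma nomePt_eq_one_iff (τ u : ℂ) (j : ℤ) :
    nomePt τ u j = 1 ↔ ∃ a : ℤ, u = a * 2 - j * (2 * τ) := by
  have hpi : (Real.pi : ℂ) * I ≠ 0 := by simp [Real.pi_ne_zero]
  rw [nomePt, Complex.exp_eq_one_iff]
  refine exists_congr fun a => ⟨fun h => ?_, fun h => ?_⟩
  · apply mul_left_cancel₀ hpi
    linear_combination h
  · rw [h]
    ring

lemma forall_nomePt_ne_one_iff (τ u : ℂ) : (∀ j, nomePt τ u j ≠ 1) ↔ ¬ InLattice τ u := by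
  rw [← not_exists, not_iff_not]
  constructor
  · rintro ⟨j, hj⟩
    obtain ⟨a, ha⟩ := (nomePt_eq_one_iff τ u j).mp hj
    exact ⟨a, -j, by rw [ha]; push_cast; ring⟩
  · rintro ⟨a, b, rfl⟩
    exact ⟨-b, (nomePt_eq_one_iff _ _ _).mpr ⟨a, by push_cast; ring⟩⟩

lemma eventually_int_eq (x₀ : ℝ) : ∀ᶠ x : ℝ in 𝓝 x₀, ∀ k : ℤ, x = k → x = x₀ := by
  have h1 : (⌈x₀⌉ : ℝ) - 1 < x₀ := by linarith [Int.ceil_lt_add_one x₀]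
  filter_upwards [Ioo_mem_nhds h1 (Int.lt_floor_add_one x₀)] with x hx k hk
  obtain ⟨h2, h3⟩ := hx
  rw [hk] at h2 h3 ⊢
  have h4 : ⌈x₀⌉ ≤ k := by
    have : (⌈x₀⌉ : ℝ) < ((k + 1 : ℤ) : ℝ) := by push_cast; linarith
    exact Int.lt_add_one_iff.mp (by exact_mod_cast this)
  have h5 : k ≤ ⌊x₀⌋ := by
    exact Int.lt_add_one_iff.mp (by exact_mod_cast h3)
  exact le_antisymm (Int.le_floor.mp h5) (Int.ceil_le.mp h4)

/-- The coordinate of `u` along `2τ`. -/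
def latY (τ u : ℂ) : ℝ := u.im / (2 * τ.im)

/-- The coordinate of `u` along `2`. -/
def latX (τ u : ℂ) : ℝ := (u.re - 2 * latY τ u * τ.re) / 2

lemma lat_decomp {τ : ℂ} (hτ : 0 < τ.im) (u : ℂ) : u = latX τ u * 2 + latY τ u * (2 * τ) := by
  apply Complex.ext
  · simp [latX]
    ring
  · have h1 : ((latY τ u : ℂ) * (2 * τ)).im = latY τ u * (2 * τ.im) := by simp
    rw [Complex.add_im, h1, latY, div_mul_cancel₀ _ (by positivity)]
    simp

lemma latY_add {τ : ℂ} (hτ : 0 < τ.im) (a b : ℝ) : latY τ (a * 2 + b * (2 * τ)) = b := by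
  simp [latY]
  field_simp

lemma latX_add {τ : ℂ} (hτ : 0 < τ.im) (a b : ℝ) : latX τ (a * 2 + b * (2 * τ)) = a := by
  simp only [latX, latY_add hτ]
  simp
  ring

lemma continuous_latY (τ : ℂ) : Continuous (latY τ) := Complex.continuous_im.div_const _

lemma continuous_latX (τ : ℂ) : Continuous (latX τ) := by
  have := continuous_latY τ
  unfold latX
  fun_prop

lemma eventually_not_inLattice {τ : ℂ} (hτ : 0 < τ.im) (u₀ : ℂ) :
    ∀ᶠ u in 𝓝[≠] u₀, ¬ InLattice τ u := by
  have hX := ((continuous_latX τ).tendsto u₀).eventually (eventually_int_eq (latX τ u₀))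
  have hY := ((continuous_latY τ).tendsto u₀).eventually (eventually_int_eq (latY τ u₀))
  filter_upwards [nhdsWithin_le_nhds hX, nhdsWithin_le_nhds hY, self_mem_nhdsWithin]
    with u h1 h2 hne
  rintro ⟨a, b, hab⟩
  have ha := latX_add hτ a b
  have hb := latY_add hτ a b
  push_cast at ha hb
  rw [← hab] at ha hb
  apply hne
  rw [Set.mem_singleton_iff, lat_decomp hτ u, lat_decomp hτ u₀, h1 a ha, h2 b hb]

/-! ### Uniqueness from quasi-periods -/

section Uniqueness

variable {τ : ℂ} {f : ℂ → ℂ}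

/-- The modulus of `f` times `e^{π (Im u)^2 / (4 Im τ)}`, put to zero on the lattice. -/
def gaussNorm (τ : ℂ) (f : ℂ → ℂ) (u : ℂ) : ℝ :=
  open Classical in
  if InLattice τ u then 0 else ‖f u‖ * Real.exp (Real.pi * u.im ^ 2 / (4 * τ.im))

lemma gaussNorm_periodic_two (h1 : ∀ u, ¬ InLattice τ u → f (u + 2) = -f u) :
    Function.Periodic (gaussNorm τ f) 2 := fun u => by
  have hiff := inLattice_add_iff (inLattice_two τ) u
  by_cases h : InLattice τ u
  · rw [gaussNorm, gaussNorm, if_pos h, if_pos (hiff.mpr h)]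
  · rw [gaussNorm, gaussNorm, if_neg h, if_neg (mt hiff.mp h)]
    rw [h1 u h, norm_neg]
    simp

/-- The weight is chosen so that (Im u + 2 Im τ)² - (Im u)² = 4 Im τ (Im u + Im τ) offsets the
modulus of e^{πi(u+τ)}. -/
lemma gaussNorm_periodic_two_mul (hτ : 0 < τ.im)
    (h2 : ∀ u, ¬ InLattice τ u → f (u + 2 * τ) = -(cexp (Real.pi * I * (u + τ)) * f u)) :
    Function.Periodic (gaussNorm τ f) (2 * τ) := fun u => by
  have hiff := inLattice_add_iff (inLattice_two_mul τ) u
  by_cases h : InLattice τ u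
  · rw [gaussNorm, gaussNorm, if_pos h, if_pos (hiff.mpr h)]
  · rw [gaussNorm, gaussNorm, if_neg h, if_neg (mt hiff.mp h)]
    rw [h2 u h, norm_neg, norm_mul, Complex.norm_exp, mul_right_comm, ← Real.exp_add, mul_comm]
    congr 2
    simp
    field_simp
    ring

lemma gaussNorm_periodic (hτ : 0 < τ.im) (h1 : ∀ u, ¬ InLattice τ u → f (u + 2) = -f u)
    (h2 : ∀ u, ¬ InLattice τ u → f (u + 2 * τ) = -(cexp (Real.pi * I * (u + τ)) * f u))
    {v : ℂ} (hv : InLattice τ v) : Function.Periodic (gaussNorm τ f) v := by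
  obtain ⟨a, b, rfl⟩ := hv
  exact ((gaussNorm_periodic_two h1).int_mul a).add_period
    ((gaussNorm_periodic_two_mul hτ h2).int_mul b)

/-- Invariance of `gaussNorm` carries the removable singularity at 0 to every lattice point, since
the Gaussian weights are continuous and nowhere zero. -/
lemma tendsto_sub_mul_of_periodic (hτ : 0 < τ.im)
    (h1 : ∀ u, ¬ InLattice τ u → f (u + 2) = -f u)
    (h2 : ∀ u, ¬ InLattice τ u → f (u + 2 * τ) = -(cexp (Real.pi * I * (u + τ)) * f u))
    (h0 : Tendsto (fun u => u * f u) (𝓝[≠] 0) (𝓝 0)) {v : ℂ} (hv : InLattice τ v) :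
    Tendsto (fun u => (u - v) * f u) (𝓝[≠] v) (𝓝 0) := by
  have hshift : Tendsto (fun u => u - v) (𝓝[≠] v) (𝓝[≠] 0) := by
    refine tendsto_nhdsWithin_iff.mpr ⟨?_, ?_⟩
    · have : Continuous fun u : ℂ => u - v := by fun_prop
      simpa using (this.tendsto v).mono_left nhdsWithin_le_nhds
    · filter_upwards [self_mem_nhdsWithin] with u hu
      simpa [sub_eq_zero] using hu
  have h3 := (h0.comp hshift).norm
  have hcont : Continuous fun u : ℂ => Real.exp (Real.pi * (u - v).im ^ 2 / (4 * τ.im))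
      * Real.exp (-(Real.pi * u.im ^ 2 / (4 * τ.im))) := by fun_prop
  have h4 := h3.mul ((hcont.tendsto v).mono_left nhdsWithin_le_nhds)
  rw [norm_zero, zero_mul] at h4
  rw [tendsto_zero_iff_norm_tendsto_zero]
  refine h4.congr' ?_
  filter_upwards [eventually_not_inLattice hτ v] with u hu
  have hper := gaussNorm_periodic hτ h1 h2 hv (u - v)
  have hu' : ¬ InLattice τ (u - v) := by
    rwa [← inLattice_add_iff hv, sub_add_cancel]
  rw [sub_add_cancel, gaussNorm, gaussNorm, if_neg hu, if_neg hu'] at hper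
  simp only [Function.comp_apply, norm_mul]
  calc ‖u - v‖ * ‖f (u - v)‖ * (Real.exp (Real.pi * (u - v).im ^ 2 / (4 * τ.im))
        * Real.exp (-(Real.pi * u.im ^ 2 / (4 * τ.im))))
      = ‖u - v‖ * (‖f (u - v)‖ * Real.exp (Real.pi * (u - v).im ^ 2 / (4 * τ.im)))
        * Real.exp (-(Real.pi * u.im ^ 2 / (4 * τ.im))) := by ring
    _ = ‖u - v‖ * ‖f u‖ := by
      rw [← hper, mul_assoc, mul_assoc, ← Real.exp_add, add_neg_cancel, Real.exp_zero, mul_one]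

/-- The extension of `f` by its limits. -/
def limExt (f : ℂ → ℂ) (u : ℂ) : ℂ := limUnder (𝓝[≠] u) f

lemma limExt_eq {u : ℂ} (h : ContinuousAt f u) : limExt f u = f u :=
  (h.tendsto.mono_left nhdsWithin_le_nhds).limUnder_eq

/-- Riemann's removable singularity theorem at each point. The value f(u) is arbitrary at a
singularity, but (w-u) f(u) tends to 0 anyway. -/
lemma differentiable_limExt (hd : ∀ u, ∀ᶠ w in 𝓝[≠] u, DifferentiableAt ℂ f w)
    (ht : ∀ u, Tendsto (fun w => (w - u) * f w) (𝓝[≠] u) (𝓝 0)) :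
    Differentiable ℂ (limExt f) := fun u => by
  obtain ⟨s, hs, hsd⟩ : ∃ s ∈ 𝓝 u, ∀ w ∈ s, w ≠ u → DifferentiableAt ℂ f w := by
    have := eventually_nhdsWithin_iff.mp (hd u)
    exact ⟨_, this, fun w hw hne => hw hne⟩
  have ho : (fun w => f w - f u) =o[𝓝[≠] u] fun w => (w - u)⁻¹ := by
    rw [Asymptotics.isLittleO_iff_tendsto']
    · have hc : Continuous fun w : ℂ => (w - u) * f u := by fun_prop
      have h2 := (ht u).sub ((hc.tendsto u).mono_left nhdsWithin_le_nhds)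
      simp only [sub_self, zero_mul] at h2
      refine h2.congr fun w => ?_
      rw [div_inv_eq_mul]
      ring
    · filter_upwards [self_mem_nhdsWithin] with w hw h
      exact absurd (inv_eq_zero.mp h) (sub_ne_zero.mpr hw)
  have h3 := Complex.differentiableOn_update_limUnder_of_isLittleO hs
    (fun w hw => (hsd w hw.1 hw.2).differentiableWithinAt) ho
  refine (h3.differentiableAt hs).congr_of_eventuallyEq ?_
  filter_upwards [hs] with w hw
  by_cases hwu : w = u
  · rw [hwu, Function.update_self]
    rfl
  · rw [Function.update_of_ne hwu, limExt_eq (hsd w hw hwu).continuousAt]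

/-- A function with simple quasi-periods of negative index and only removable singularities
vanishes. -/
theorem eq_zero_of_quasiPeriodic (hτ : 0 < τ.im)
    (h1 : ∀ u, ¬ InLattice τ u → f (u + 2) = -f u)
    (h2 : ∀ u, ¬ InLattice τ u → f (u + 2 * τ) = -(cexp (Real.pi * I * (u + τ)) * f u))
    (hd : ∀ u, ¬ InLattice τ u → DifferentiableAt ℂ f u)
    (h0 : Tendsto (fun u => u * f u) (𝓝[≠] 0) (𝓝 0)) {u : ℂ} (hu : ¬ InLattice τ u) :
    f u = 0 := by
  have hent : Differentiable ℂ (limExt f) := by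
    refine differentiable_limExt
      (fun v => (eventually_not_inLattice hτ v).mono fun w hw => hd w hw) fun v => ?_
    by_cases hv : InLattice τ v
    · exact tendsto_sub_mul_of_periodic hτ h1 h2 h0 hv
    · have hc : ContinuousAt (fun w => (w - v) * f w) v := by
        have := (hd v hv).continuousAt
        fun_prop
      simpa using hc.tendsto.mono_left nhdsWithin_le_nhds
  have hext {v : ℂ} (hv : ¬ InLattice τ v) : limExt f v = f v := limExt_eq (hd v hv).continuousAt
  -- `gaussNorm` is lattice invariant, so a bound on a compact fundamental parallelogram is enough.
  obtain ⟨C, hC⟩ : ∃ C : ℝ, ∀ v, ¬ InLattice τ v → gaussNorm τ f v ≤ C := by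
    have hcompact : IsCompact ((fun p : ℝ × ℝ => (p.1 : ℂ) * 2 + p.2 * (2 * τ)) ''
        (Set.Icc 0 1 ×ˢ Set.Icc 0 1)) :=
      (isCompact_Icc.prod isCompact_Icc).image (by fun_prop)
    have hcont : Continuous fun v : ℂ =>
        ‖limExt f v‖ * Real.exp (Real.pi * v.im ^ 2 / (4 * τ.im)) := by
      have := hent.continuous
      fun_prop
    obtain ⟨C, hC⟩ := hcompact.bddAbove_image hcont.continuousOn
    refine ⟨C, fun v hv => ?_⟩
    have hlat : InLattice τ ((⌊latX τ v⌋ : ℂ) * 2 + (⌊latY τ v⌋ : ℂ) * (2 * τ)) := ⟨_, _, rfl⟩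
    have hper := (gaussNorm_periodic hτ h1 h2 hlat).sub_eq v
    set w := v - ((⌊latX τ v⌋ : ℂ) * 2 + (⌊latY τ v⌋ : ℂ) * (2 * τ)) with hw
    have hwl : ¬ InLattice τ w := by
      rwa [← inLattice_add_iff hlat, hw, sub_add_cancel]
    rw [← hper, gaussNorm, if_neg hwl, ← hext hwl]
    refine hC ⟨w, ⟨(Int.fract (latX τ v), Int.fract (latY τ v)), ?_, ?_⟩, rfl⟩
    · exact ⟨⟨Int.fract_nonneg _, (Int.fract_lt_one _).le⟩,
        ⟨Int.fract_nonneg _, (Int.fract_lt_one _).le⟩⟩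
    · simp only [Int.fract, hw]
      push_cast
      linear_combination -lat_decomp hτ v
  -- The Gaussian weight is at least 1, so the same constant bounds the function itself.
  have hbound (v : ℂ) (hv : ¬ InLattice τ v) : ‖limExt f v‖ ≤ C := by
    refine le_trans ?_ (hC v hv)
    rw [gaussNorm, if_neg hv, hext hv]
    refine le_mul_of_one_le_right (norm_nonneg _) (Real.one_le_exp ?_)
    have := Real.pi_pos
    positivity
  have hbdd : Bornology.IsBounded (Set.range (limExt f)) := by
    rw [isBounded_iff_forall_norm_le]
    refine ⟨C, ?_⟩
    rintro _ ⟨v, rfl⟩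
    exact le_of_tendsto ((hent.continuous.norm.tendsto v).mono_left nhdsWithin_le_nhds)
      ((eventually_not_inLattice hτ v).mono hbound)
  -- By Liouville the extension is constant, and a constant that changes sign under u ↦ u + 2 is 0.
  have hu2 : ¬ InLattice τ (u + 2) := by rwa [inLattice_add_iff (inLattice_two τ)]
  have heq := hent.apply_eq_apply_of_bounded hbdd (u + 2) u
  rw [hext hu2, hext hu, h1 u hu] at heq
  linear_combination (-1 / 2 : ℂ) * heq

end Uniqueness

/-! ### The Appell sum behind the reciprocal theta function -/

lemma norm_neg_one_zpow (j : ℤ) : ‖(-1 : ℂ) ^ j‖ = 1 := by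
  rw [norm_zpow, norm_neg, norm_one, one_zpow]

/-- The weight `(-1)^J q^{J(J+1)/2 - NJ}`. -/
def poleWeight (τ : ℂ) (N J : ℤ) : ℂ :=
  (-1) ^ J * qPow τ ((J : ℝ) * (J + 1) / 2 - N * J)

/-- The Appell-type sum `Σ_J (-1)^J q^{J(J+1)/2 - NJ} / (1 - e^{πiu} q^J)`. -/
def poleSeries (τ : ℂ) (N : ℤ) (u : ℂ) : ℂ :=
  ∑' J : ℤ, poleWeight τ N J * (1 - nomePt τ u J)⁻¹

lemma summable_norm_poleWeight {τ : ℂ} (hτ : 0 < τ.im) (N : ℤ) :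
    Summable fun J => ‖poleWeight τ N J‖ := by
  have hpi := Real.pi_pos
  refine (summable_exp_quadratic (A := Real.pi * τ.im) (by positivity)
    (-(2 * Real.pi * τ.im * (1 / 2 - N))) 0).congr fun J => ?_
  rw [poleWeight, norm_mul, norm_neg_one_zpow, one_mul, norm_qPow]
  congr 1
  ring

lemma inv_one_sub_eq (x : ℂ) : (1 - x)⁻¹ = geomKernel 0 1 x := by
  simp [geomKernel]

lemma summable_poleSeries {τ : ℂ} (hτ : 0 < τ.im) (N : ℤ) (u : ℂ) :
    Summable fun J : ℤ => poleWeight τ N J * (1 - nomePt τ u J)⁻¹ := by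
  obtain ⟨C, hC0, hC⟩ := exists_geomKernel_bound hτ u (n := 0) (M := 1) one_pos
  refine Summable.of_norm_bounded ((summable_norm_poleWeight hτ N).mul_right C) fun J => ?_
  rw [norm_mul, inv_one_sub_eq]
  exact mul_le_mul_of_nonneg_left (hC J) (norm_nonneg _)

/-- The reflection J ↦ 2N-1-J fixes the exponent J(J+1-2N)/2 and reverses the sign (-1)^J. -/
lemma tsum_poleWeight {τ : ℂ} (N : ℤ) : ∑' J : ℤ, poleWeight τ N J = 0 := by
  have h1 : ∑' J : ℤ, poleWeight τ N (2 * N - 1 - J) = ∑' J : ℤ, poleWeight τ N J :=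
    (Equiv.subLeft (2 * N - 1)).tsum_eq (poleWeight τ N)
  have h2 (J : ℤ) : poleWeight τ N (2 * N - 1 - J) = -poleWeight τ N J := by
    have hs : (-1 : ℂ) ^ (2 * N - 1 - J) = -(-1) ^ J := by
      rw [show 2 * N - 1 - J = 2 * (N - J - 1) + J + 1 by ring, zpow_add₀ (by norm_num),
        zpow_add₀ (by norm_num), zpow_mul]
      norm_num
    simp only [poleWeight, hs, neg_mul]
    congr 3
    push_cast
    ring
  simp_rw [h2, tsum_neg] at h1
  linear_combination (-1 / 2 : ℂ) * h1

/-- Use 1/(1-x) = x/(1-x) + 1 with x = e^{πiu}q^J: the factor q^J lowers N+1 to N, and the leftover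
weights sum to 0. -/
lemma poleSeries_succ {τ : ℂ} (hτ : 0 < τ.im) (N : ℤ) {u : ℂ} (hu : ¬ InLattice τ u) :
    poleSeries τ (N + 1) u = cexp (Real.pi * I * u) * poleSeries τ N u := by
  have hne := (forall_nomePt_ne_one_iff τ u).mpr hu
  have h1 (J : ℤ) : poleWeight τ (N + 1) J * (1 - nomePt τ u J)⁻¹
      = cexp (Real.pi * I * u) * (poleWeight τ N J * (1 - nomePt τ u J)⁻¹)
        + poleWeight τ (N + 1) J := by
    have h2 : 1 - nomePt τ u J ≠ 0 := sub_ne_zero.mpr (hne J).symm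
    have h3 : poleWeight τ N J = poleWeight τ (N + 1) J * qPow τ J := by
      rw [poleWeight, poleWeight, mul_assoc, ← qPow_add]
      congr 2
      push_cast
      ring
    have h4 := nomePt_eq τ u J
    rw [h3]
    field_simp
    rw [h4]
    ring
  rw [poleSeries, tsum_congr h1, Summable.tsum_add ((summable_poleSeries hτ N u).mul_left _)
    (summable_norm_poleWeight hτ (N + 1)).of_norm, tsum_poleWeight, add_zero, tsum_mul_left,
    poleSeries]

lemma poleSeries_eq {τ : ℂ} (hτ : 0 < τ.im) {u : ℂ} (hu : ¬ InLattice τ u) (N : ℤ) :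
    poleSeries τ N u = cexp (Real.pi * I * N * u) * poleSeries τ 0 u := by
  have hexp (k : ℤ) : cexp (Real.pi * I * (k + 1 : ℤ) * u)
      = cexp (Real.pi * I * u) * cexp (Real.pi * I * k * u) := by
    rw [← Complex.exp_add]
    congr 1
    push_cast
    ring
  induction N using Int.induction_on with
  | zero => simp
  | succ i ih => rw [poleSeries_succ hτ _ hu, ih, hexp, ← mul_assoc]
  | pred i ih =>
    have h1 := poleSeries_succ hτ (-(i : ℤ) - 1) hu
    have h2 := hexp (-(i : ℤ) - 1)
    rw [sub_add_cancel] at h1 h2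
    apply mul_left_cancel₀ (Complex.exp_ne_zero (Real.pi * I * u))
    rw [← h1, ih, ← mul_assoc, ← h2]

/-- Substituting J ↦ J - k trades the shift of the poles for a change of N to N + k, which
`poleSeries_eq` absorbs into an exponential. -/
lemma tsum_poleWeight_shift {τ : ℂ} (hτ : 0 < τ.im) {u : ℂ} (hu : ¬ InLattice τ u) (N k : ℤ) :
    ∑' J : ℤ, poleWeight τ N J * (1 - nomePt τ u (k + J))⁻¹
      = (-1) ^ k * qPow τ ((k : ℝ) * (k - 1) / 2 + N * k)
        * (cexp (Real.pi * I * (N + k) * u) * poleSeries τ 0 u) := by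
  have h1 := (Equiv.subRight k).tsum_eq
    fun J : ℤ => poleWeight τ N J * (1 - nomePt τ u (k + J))⁻¹
  rw [← h1]
  have h2 (J : ℤ) : poleWeight τ N (Equiv.subRight k J)
        * (1 - nomePt τ u (k + Equiv.subRight k J))⁻¹
      = (-1) ^ k * qPow τ ((k : ℝ) * (k - 1) / 2 + N * k)
        * (poleWeight τ (N + k) J * (1 - nomePt τ u J)⁻¹) := by
    have hs : (-1 : ℂ) ^ (J - k) = (-1) ^ k * (-1) ^ J := by
      rw [show J - k = -(2 * k) + (k + J) by ring, zpow_add₀ (by norm_num), zpow_neg, zpow_mul,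
        zpow_add₀ (by norm_num)]
      norm_num
    have hq : qPow τ (((J - k : ℤ) : ℝ) * (((J - k : ℤ) : ℝ) + 1) / 2 - N * ((J - k : ℤ) : ℝ))
        = qPow τ ((k : ℝ) * (k - 1) / 2 + N * k)
          * qPow τ ((J : ℝ) * (J + 1) / 2 - ((N + k : ℤ) : ℝ) * J) := by
      rw [← qPow_add]
      congr 1
      push_cast
      ring
    rw [Equiv.subRight_apply, add_sub_cancel, poleWeight, poleWeight, hs, hq]
    ring
  rw [tsum_congr h2, tsum_mul_left]
  change _ * poleSeries τ (N + k) u = _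
  rw [poleSeries_eq hτ hu]
  push_cast
  rfl

/-- The meromorphic function `e^{πiu/2} Σ_J (-1)^J q^{J(J+1)/2} / (1 - e^{πiu} q^J)`, a constant
multiple of the reciprocal of the odd Jacobi theta function. -/
def invTheta (τ u : ℂ) : ℂ := cexp (Real.pi * I * u / 2) * poleSeries τ 0 u

lemma nomePt_add_two (τ u : ℂ) (j : ℤ) : nomePt τ (u + 2) j = nomePt τ u j := by
  simp only [nomePt]
  rw [show Real.pi * I * (u + 2 + 2 * j * τ) = Real.pi * I * (u + 2 * j * τ) + 2 * Real.pi * I by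
    ring, Complex.exp_periodic]

lemma exp_add_pi_mul_I (x : ℂ) : cexp (x + Real.pi * I) = -cexp x := by
  rw [Complex.exp_add, Complex.exp_pi_mul_I, mul_neg_one]

lemma invTheta_add_two (τ u : ℂ) : invTheta τ (u + 2) = -invTheta τ u := by
  simp only [invTheta, poleSeries, nomePt_add_two]
  rw [show Real.pi * I * (u + 2) / 2 = Real.pi * I * u / 2 + Real.pi * I by ring,
    exp_add_pi_mul_I, neg_mul]

lemma invTheta_add_two_mul {τ : ℂ} (hτ : 0 < τ.im) {u : ℂ} (hu : ¬ InLattice τ u) :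
    invTheta τ (u + 2 * τ) = -(cexp (Real.pi * I * (u + τ)) * invTheta τ u) := by
  have h1 := tsum_poleWeight_shift hτ hu 0 1
  have h2 (J : ℤ) : nomePt τ u (1 + J) = nomePt τ (u + 2 * τ) J := by
    rw [add_comm, nomePt_add]
    simp
  simp_rw [h2] at h1
  rw [invTheta, invTheta, poleSeries, h1]
  simp only [Int.cast_one, Int.cast_zero, sub_self, mul_zero, zero_div, add_zero,
    zpow_one, qPow, Complex.ofReal_zero, Complex.exp_zero, mul_one, zero_add]
  rw [neg_mul, mul_neg, one_mul, ← mul_assoc, ← mul_assoc, ← Complex.exp_add, ← Complex.exp_add]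
  congr 3
  ring

/-! ### Holomorphy and residue of `invTheta` -/

lemma differentiableAt_poleTerm {τ u : ℂ} (N J : ℤ) (h : nomePt τ u J ≠ 1) :
    DifferentiableAt ℂ (fun w => poleWeight τ N J * (1 - nomePt τ w J)⁻¹) u := by
  have h1 : DifferentiableAt ℂ (fun w => 1 - nomePt τ w J) u := by
    unfold nomePt
    fun_prop
  exact (h1.inv (sub_ne_zero.mpr h.symm)).const_mul _

/-- In a horizontal strip all but finitely many terms are holomorphic and dominated by twice their
weight, so the singularities come from a finite sum. -/
lemma exists_poleSeries_split {τ : ℂ} (hτ : 0 < τ.im) (N : ℤ) (B : ℝ) :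
    ∃ (K : ℕ) (F : ℂ → ℂ), DifferentiableOn ℂ F {u | |u.im| < B} ∧ ∀ u : ℂ,
      poleSeries τ N u = ∑ J ∈ Finset.Icc (-(K : ℤ)) K, poleWeight τ N J * (1 - nomePt τ u J)⁻¹
        + F u := by
  obtain ⟨K, hK⟩ := exists_nomePt_far hτ B
  set S : Finset ℤ := Finset.Icc (-(K : ℤ)) K with hS
  have hmem {J : ℤ} (hJ : J ∉ S) : (K : ℤ) < |J| := by
    rw [hS, Finset.mem_Icc, ← abs_le] at hJ
    exact not_le.mp hJ
  refine ⟨K, fun u => ∑' J : {J // J ∉ S}, poleWeight τ N J * (1 - nomePt τ u J)⁻¹, ?_,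
    fun u => ((summable_poleSeries hτ N u).sum_add_tsum_subtype_compl S).symm⟩
  have hsum : Summable fun J : {J // J ∉ S} => ‖poleWeight τ N J‖ * 2 :=
    ((summable_norm_poleWeight hτ N).mul_right 2).subtype _
  refine Complex.differentiableOn_tsum_of_summable_norm hsum (fun J u hu => ?_) ?_
    fun J u hu => ?_
  · refine (differentiableAt_poleTerm N J fun h => ?_).differentiableWithinAt
    have := hK u (le_of_lt hu) J (hmem J.2)
    rw [h, norm_one] at this
    norm_num at this
  · exact isOpen_lt (by fun_prop) continuous_const
  · rw [norm_mul, inv_one_sub_eq]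
    exact mul_le_mul_of_nonneg_left
      (norm_geomKernel_le_two one_pos (hK u (le_of_lt hu) J (hmem J.2))) (norm_nonneg _)

lemma strip_mem_nhds {u : ℂ} {B : ℝ} (hu : |u.im| < B) : {w : ℂ | |w.im| < B} ∈ 𝓝 u :=
  (isOpen_lt (by fun_prop) continuous_const).mem_nhds hu

lemma differentiableAt_invTheta {τ : ℂ} (hτ : 0 < τ.im) {u : ℂ} (hu : ¬ InLattice τ u) :
    DifferentiableAt ℂ (invTheta τ) u := by
  obtain ⟨K, F, hF, hsplit⟩ := exists_poleSeries_split hτ 0 (|u.im| + 1)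
  have hne := (forall_nomePt_ne_one_iff τ u).mpr hu
  have h1 : DifferentiableAt ℂ (poleSeries τ 0) u := by
    rw [funext hsplit]
    exact (DifferentiableAt.fun_sum fun J _ => differentiableAt_poleTerm 0 J (hne J)).add
      (hF.differentiableAt (strip_mem_nhds (lt_add_one _)))
  have h2 : DifferentiableAt ℂ (fun u : ℂ => cexp (Real.pi * I * u / 2)) u := by fun_prop
  exact h2.mul h1

/-- Only J = 0 contributes a pole at 0, with residue fixed by the derivative of 1 - e^{πiu}. It does
not depend on τ, which normalises `invTheta_S`. -/
lemma tendsto_mul_invTheta {τ : ℂ} (hτ : 0 < τ.im) :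
    Tendsto (fun u => u * invTheta τ u) (𝓝[≠] 0) (𝓝 (-(Real.pi * I)⁻¹)) := by
  obtain ⟨K, F, hF, hsplit⟩ := exists_poleSeries_split hτ 0 1
  have hpi : (Real.pi : ℂ) * I ≠ 0 := by simp [Real.pi_ne_zero]
  have h0mem : (0 : ℤ) ∈ Finset.Icc (-(K : ℤ)) K := by simp
  set S := (Finset.Icc (-(K : ℤ)) K).erase 0 with hS
  set E : ℂ → ℂ := fun u => ∑ J ∈ S, poleWeight τ 0 J * (1 - nomePt τ u J)⁻¹ + F u with hE
  have hEc : ContinuousAt E 0 := by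
    refine DifferentiableAt.continuousAt (𝕜 := ℂ) ?_
    refine (DifferentiableAt.fun_sum fun J hJ => differentiableAt_poleTerm 0 J fun h => ?_).add
      (hF.differentiableAt (strip_mem_nhds (by simp)))
    have hJ0 : J ≠ 0 := (Finset.mem_erase.mp hJ).1
    have h2 := norm_nomePt τ 0 J
    rw [h, norm_one, eq_comm, Real.exp_eq_one_iff] at h2
    have h3 : (J : ℝ) ≠ 0 := by exact_mod_cast hJ0
    have : Real.pi * ((0 : ℂ).im + 2 * J * τ.im) ≠ 0 := by
      simp [Real.pi_ne_zero, h3, hτ.ne']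
    exact this (neg_eq_zero.mp h2)
  have hsplit2 (u : ℂ) : poleSeries τ 0 u = (1 - cexp (Real.pi * I * u))⁻¹ + E u := by
    rw [hsplit, ← Finset.add_sum_erase _ _ h0mem, add_assoc]
    congr 1
    simp [poleWeight, qPow, nomePt]
  have hder : HasDerivAt (fun u : ℂ => 1 - cexp (Real.pi * I * u)) (-(Real.pi * I)) 0 := by
    have h1 : HasDerivAt (fun u : ℂ => Real.pi * I * u) (Real.pi * I) 0 := by
      simpa using (hasDerivAt_id (0 : ℂ)).const_mul (Real.pi * I)
    simpa using h1.cexp.const_sub 1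
  have hslope := (hasDerivAt_iff_tendsto_slope.mp hder).inv₀ (neg_ne_zero.mpr hpi)
  have h1 : Tendsto (fun u => u * poleSeries τ 0 u) (𝓝[≠] 0) (𝓝 (-(Real.pi * I)⁻¹)) := by
    have h2 : Tendsto (fun u => u * E u) (𝓝[≠] 0) (𝓝 0) := by
      have : ContinuousAt (fun u => u * E u) 0 := continuousAt_id.mul hEc
      simpa using this.tendsto.mono_left nhdsWithin_le_nhds
    have h3 := hslope.add h2
    rw [add_zero, inv_neg] at h3
    refine h3.congr fun u => ?_
    rw [hsplit2, slope_def_field]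
    simp [div_eq_mul_inv]
    ring
  have hc : Continuous fun u : ℂ => cexp (Real.pi * I * u / 2) := by fun_prop
  have h4 := ((hc.tendsto 0).mono_left (nhdsWithin_le_nhds (s := {0}ᶜ))).mul h1
  simp only [mul_zero, zero_div, Complex.exp_zero, one_mul] at h4
  refine h4.congr fun u => ?_
  rw [invTheta]
  ring

/-! ### Modular transformations of `invTheta` -/

lemma im_neg_one_div {τ : ℂ} (hτ : 0 < τ.im) : 0 < (-1 / τ).im := by
  have := UpperHalfPlane.im_inv_neg_coe_pos ⟨τ, hτ⟩
  rw [neg_div, one_div, ← inv_neg]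
  exact this

lemma inLattice_div_iff {τ : ℂ} (hτ : 0 < τ.im) (u : ℂ) :
    InLattice (-1 / τ) (u / τ) ↔ InLattice τ u := by
  have h0 : τ ≠ 0 := fun h => by simp [h] at hτ
  constructor
  · rintro ⟨a, b, h⟩
    refine ⟨-b, a, ?_⟩
    field_simp at h
    rw [h]
    push_cast
    ring
  · rintro ⟨a, b, rfl⟩
    refine ⟨b, -a, ?_⟩
    field_simp
    push_cast
    ring

/-- Division by τ matches the two lattices and exchanges their generators up to sign. The difference
of the two sides, suitably normalised, has the quasi-periods of `invTheta` and no residue at 0,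
hence vanishes. -/
theorem invTheta_S {τ : ℂ} (hτ : 0 < τ.im) {u : ℂ} (hu : ¬ InLattice τ u) :
    invTheta (-1 / τ) (u / τ)
      = τ * cexp (-(Real.pi * I * u ^ 2 / (4 * τ))) * invTheta τ u := by
  have h0 : τ ≠ 0 := fun h => by simp [h] at hτ
  have hτ' := im_neg_one_div hτ
  have hdiff (w : ℂ) (hw : ¬ InLattice τ w) :
      DifferentiableAt ℂ (fun w => invTheta (-1 / τ) (w / τ)) w := by
    have h1 := differentiableAt_invTheta hτ' (mt (inLattice_div_iff hτ w).mp hw)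
    exact h1.comp w (differentiableAt_id.div_const τ)
  set f : ℂ → ℂ := fun w => τ⁻¹ * cexp (Real.pi * I * w ^ 2 / (4 * τ))
    * invTheta (-1 / τ) (w / τ) - invTheta τ w with hf
  have key : f u = 0 := by
    refine eq_zero_of_quasiPeriodic (f := f) hτ (fun w hw => ?_) (fun w hw => ?_) (fun w hw => ?_)
      ?_ hu
    -- The shift by 2 becomes minus the second period 2(-1/τ), so the quasi-period law is applied at
    -- (w+2)/τ and read backwards.
    · have hw2 : ¬ InLattice (-1 / τ) ((w + 2) / τ) := by
        rwa [inLattice_div_iff hτ, inLattice_add_iff (inLattice_two τ)]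
      have h1 := invTheta_add_two_mul hτ' hw2
      have h2 : (w + 2) / τ + 2 * (-1 / τ) = w / τ := by field_simp; ring
      rw [h2] at h1
      have h3 : cexp (Real.pi * I * (w + 2) ^ 2 / (4 * τ))
          = cexp (Real.pi * I * w ^ 2 / (4 * τ))
            * cexp (Real.pi * I * ((w + 2) / τ + -1 / τ)) := by
        rw [← Complex.exp_add]
        congr 1
        field_simp
        ring
      simp only [hf, invTheta_add_two, h1, h3]
      ring
    · have h1 : (w + 2 * τ) / τ = w / τ + 2 := by field_simp
      have h3 : cexp (Real.pi * I * (w + 2 * τ) ^ 2 / (4 * τ))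
          = cexp (Real.pi * I * w ^ 2 / (4 * τ)) * cexp (Real.pi * I * (w + τ)) := by
        rw [← Complex.exp_add]
        congr 1
        field_simp
        ring
      simp only [hf, h1, invTheta_add_two, invTheta_add_two_mul hτ hw, h3]
      ring
    · have h1 := hdiff w hw
      have h2 := differentiableAt_invTheta hτ hw
      have h3 : DifferentiableAt ℂ (fun w : ℂ => τ⁻¹ * cexp (Real.pi * I * w ^ 2 / (4 * τ))) w := by
        fun_prop
      exact (h3.mul h1).sub h2
    -- The factor τ⁻¹ compensates for the rescaling: w τ⁻¹ = w/τ, so both residues are the same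
    -- constant.
    · have hdiv : Tendsto (fun w : ℂ => w / τ) (𝓝[≠] 0) (𝓝[≠] 0) := by
        refine tendsto_nhdsWithin_iff.mpr ⟨?_, ?_⟩
        · have : Continuous fun w : ℂ => w / τ := by fun_prop
          simpa using (this.tendsto 0).mono_left nhdsWithin_le_nhds
        · filter_upwards [self_mem_nhdsWithin] with w hw
          simpa [h0] using hw
      have h1 := (tendsto_mul_invTheta hτ').comp hdiv
      have hc : Continuous fun w : ℂ => cexp (Real.pi * I * w ^ 2 / (4 * τ)) := by fun_prop
      have h2 := ((hc.tendsto 0).mono_left (nhdsWithin_le_nhds (s := {0}ᶜ))).mul h1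
      have h3 := h2.sub (tendsto_mul_invTheta hτ)
      simp only [ne_eq, OfNat.ofNat_ne_zero, not_false_eq_true, zero_pow, mul_zero, zero_div,
        Complex.exp_zero, one_mul, sub_self] at h3
      refine h3.congr fun w => ?_
      simp only [hf, Function.comp_apply]
      ring
  have h1 : τ⁻¹ * cexp (Real.pi * I * u ^ 2 / (4 * τ)) * invTheta (-1 / τ) (u / τ)
      = invTheta τ u := sub_eq_zero.mp key
  rw [← h1, Complex.exp_neg]
  field_simp

lemma invTheta_T (τ u : ℂ) : invTheta (τ + 1) u = invTheta τ u := by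
  have h1 (J : ℤ) : poleWeight (τ + 1) 0 J = poleWeight τ 0 J := by
    obtain ⟨k, hk⟩ := Int.even_mul_succ_self J
    rw [poleWeight, poleWeight, qPow_add_one_of_int τ _ k]
    have : (J : ℝ) * (J + 1) = k + k := by exact_mod_cast hk
    push_cast
    linarith
  have h2 (J : ℤ) : nomePt (τ + 1) u J = nomePt τ u J := by
    rw [nomePt, nomePt, show Real.pi * I * (u + 2 * J * (τ + 1))
      = Real.pi * I * (u + 2 * J * τ) + J * (2 * Real.pi * I) by ring,
      Complex.exp_periodic.int_mul J]
  simp only [invTheta, poleSeries, h1, h2]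

/-! ### Theta series: convergence and modular transformations -/

lemma norm_thetaTerm {ε : ℂ} (hε : ‖ε‖ = 1) (k : ℝ) {μ : ℝ} (hμ : 0 < μ) (τ u : ℂ) (j : ℤ) :
    ‖thetaTerm ε k μ τ u j‖ = Real.exp (-((2 * Real.pi * τ.im * μ) * (j : ℝ) ^ 2)
      + (-(2 * Real.pi * (μ * u.im + τ.im * k))) * j
      + (-(Real.pi * k * u.im + Real.pi * τ.im * k ^ 2 / (2 * μ)))) := by
  have h1 : (2 * Real.pi * I * μ * ((j : ℂ) + k / (2 * μ)) * u)
      = ((2 * Real.pi * μ * (j + k / (2 * μ)) : ℝ) : ℂ) * (I * u) := by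
    push_cast
    ring
  rw [thetaTerm, norm_mul, norm_mul, norm_zpow, hε, one_zpow, one_mul, norm_qPow, h1,
    Complex.norm_exp, ← Real.exp_add]
  congr 1
  rw [Complex.re_ofReal_mul]
  simp only [Complex.mul_re, Complex.I_re, Complex.I_im]
  field_simp
  ring

lemma summable_thetaTerm {ε : ℂ} (hε : ‖ε‖ = 1) (k : ℝ) {μ : ℝ} (hμ : 0 < μ) {τ : ℂ}
    (hτ : 0 < τ.im) (u : ℂ) : Summable (thetaTerm ε k μ τ u) := by
  refine Summable.of_norm ?_
  simp_rw [norm_thetaTerm hε k hμ]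
  have := Real.pi_pos
  exact summable_exp_quadratic (by positivity) _ _

lemma neg_one_zpow_eq (j : ℤ) : (-1 : ℂ) ^ j = cexp (Real.pi * I * j) := by
  rw [mul_comm, Complex.exp_int_mul, Complex.exp_pi_mul_I]

/-- The odd multiple 2ν+1 of πi is the one that makes the exponents in `thetaMinus_S` agree
identically. -/
lemma neg_one_zpow_eq_odd (j : ℤ) (ν : ℕ) :
    (-1 : ℂ) ^ j = cexp (-(2 * Real.pi * I * (ν + 1 / 2) * j)) := by
  rw [neg_one_zpow_eq, Complex.exp_eq_exp_iff_exists_int]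
  exact ⟨(ν + 1) * j, by push_cast; ring⟩

lemma thetaMinus_eq_jacobiTheta₂ (k : ℝ) {κ : ℝ} (hκ : 0 < κ) (τ u : ℂ) :
    thetaMinus k (κ / 2) τ u = cexp (Real.pi * I * k * u + Real.pi * I * τ * k ^ 2 / κ)
      * jacobiTheta₂ (κ * u / 2 + k * τ + 1 / 2) (κ * τ) := by
  have h0 : (κ : ℂ) ≠ 0 := by exact_mod_cast hκ.ne'
  rw [thetaMinus, jacobiTheta₂, ← tsum_mul_left]
  refine tsum_congr fun j => ?_
  rw [thetaTerm, qPow, jacobiTheta₂_term, neg_one_zpow_eq, ← Complex.exp_add, ← Complex.exp_add,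
    ← Complex.exp_add]
  congr 1
  push_cast
  field_simp
  ring

lemma jacobiTheta₂_neg_div {τ : ℂ} (hτ : 0 < τ.im) {κ : ℝ} (hκ : 0 < κ) (w : ℂ) :
    jacobiTheta₂ (κ * w / τ) (-κ / τ)
      = (-I * τ) ^ (1 / 2 : ℂ) / (Real.sqrt κ : ℂ) * cexp (Real.pi * I * κ * w ^ 2 / τ)
        * jacobiTheta₂ w (τ / κ) := by
  have h0 : τ ≠ 0 := fun h => by simp [h] at hτ
  have hκ0 : (κ : ℂ) ≠ 0 := by exact_mod_cast hκ.ne'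
  have hne : -I * τ ≠ 0 := by simp [h0]
  have hpow : (-I * (τ / κ)) ^ (1 / 2 : ℂ) = (-I * τ) ^ (1 / 2 : ℂ) / (Real.sqrt κ : ℂ) := by
    have hmul : ((κ : ℝ) : ℂ) * (-I * (τ / κ)) = -I * τ := by field_simp
    have hsq : (κ : ℂ) ^ (1 / 2 : ℂ) = (Real.sqrt κ : ℂ) := by
      rw [Real.sqrt_eq_rpow, Complex.ofReal_cpow hκ.le]
      norm_num
    have hs0 : (Real.sqrt κ : ℂ) ≠ 0 := by exact_mod_cast (Real.sqrt_pos.mpr hκ).ne'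
    rw [eq_div_iff hs0, mul_comm, ← hmul, ← hsq]
    have hne2 : -I * (τ / κ) ≠ 0 := by simp [h0, hκ0]
    rw [Complex.cpow_def_of_ne_zero hκ0, Complex.cpow_def_of_ne_zero hne2,
      Complex.cpow_def_of_ne_zero (mul_ne_zero hκ0 hne2), ← Complex.exp_add,
      Complex.log_ofReal_mul hκ hne2, Complex.ofReal_log hκ.le]
    congr 1
    ring
  have h1 := jacobiTheta₂_functional_equation w (τ / κ)
  have h2 : w / (τ / κ) = κ * w / τ := by field_simp
  have h3 : -1 / (τ / κ) = -κ / τ := by field_simp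
  have h4 : -(Real.pi : ℂ) * I * w ^ 2 / (τ / κ) = -(Real.pi * I * κ * w ^ 2 / τ) := by field_simp
  rw [h2, h3, h4, hpow, Complex.exp_neg] at h1
  rw [h1]
  have hs0 : (Real.sqrt κ : ℂ) ≠ 0 := by exact_mod_cast (Real.sqrt_pos.mpr hκ).ne'
  have hc0 : (-I * τ) ^ (1 / 2 : ℂ) ≠ 0 := by simp [Complex.cpow_eq_zero_iff, h0]
  have he0 := Complex.exp_ne_zero (Real.pi * I * κ * w ^ 2 / τ)
  field_simp

lemma tsum_int_eq_sum_tsum {κ : ℕ} (hκ : 0 < κ) {f : ℤ → ℂ} (hf : Summable f) :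
    ∑' N : ℤ, f N = ∑ r ∈ Finset.range κ, ∑' j : ℤ, f (j * κ + r) := by
  have : NeZero κ := ⟨hκ.ne'⟩
  have hs : Summable fun p : ℤ × Fin κ => f ((Int.divModEquiv κ).symm p) :=
    (Int.divModEquiv κ).symm.summable_iff.mpr hf
  rw [← (Int.divModEquiv κ).symm.tsum_eq f, hs.tsum_prod, ← Summable.tsum_comm, tsum_fintype,
    Finset.sum_range]
  · rfl
  · exact hs

/-- Poisson summation produces a Jacobi theta series at τ/κ; splitting its index modulo κ returns to
theta series at τ, one for each ν'. -/
theorem thetaMinus_S {τ : ℂ} (hτ : 0 < τ.im) {κ : ℕ} (hκ : 0 < κ) (ν : ℕ) (u : ℂ) :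
    thetaMinus ((ν : ℝ) + 1 / 2) ((κ : ℝ) / 2) (-1 / τ) (u / τ)
      = (-I * τ) ^ (1 / 2 : ℂ) / (Real.sqrt κ : ℂ) * cexp (Real.pi * I * κ * u ^ 2 / (4 * τ))
        * ∑ ν' ∈ Finset.range κ, cexp (-(2 * Real.pi * I / κ * (ν + 1 / 2) * (ν' + 1 / 2)))
          * thetaMinus ((ν' : ℝ) + 1 / 2) ((κ : ℝ) / 2) τ u := by
  have h0 : τ ≠ 0 := fun h => by simp [h] at hτ
  have hκ' : (0 : ℝ) < κ := by exact_mod_cast hκ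
  have hκ0 : (κ : ℂ) ≠ 0 := by exact_mod_cast hκ.ne'
  set k : ℝ := (ν : ℝ) + 1 / 2 with hk
  have hkc : (k : ℂ) = ν + 1 / 2 := by rw [hk]; push_cast; ring
  -- Solves κw/τ = κ(u/τ)/2 - k/τ + 1/2, the argument of the Jacobi function at -1/τ.
  set w : ℂ := u / 2 - k / κ + τ / (2 * κ) with hw
  have hz : (((κ : ℝ) : ℂ) * (u / τ) / 2 + k * (-1 / τ) + 1 / 2) = ((κ : ℝ) : ℂ) * w / τ := by
    rw [hw]
    push_cast
    field_simp
    ring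
  have hz2 : ((κ : ℝ) : ℂ) * (-1 / τ) = -((κ : ℝ) : ℂ) / τ := by ring
  have him : 0 < (τ / ((κ : ℝ) : ℂ)).im := by
    rw [Complex.div_ofReal_im]
    positivity
  have hsum := (summable_jacobiTheta₂_term_iff w (τ / ((κ : ℝ) : ℂ))).mpr him
  rw [thetaMinus_eq_jacobiTheta₂ k hκ', hz, hz2, jacobiTheta₂_neg_div hτ hκ', jacobiTheta₂,
    tsum_int_eq_sum_tsum hκ hsum, Finset.mul_sum, Finset.mul_sum, Finset.mul_sum]
  refine Finset.sum_congr rfl fun ν' _ => ?_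
  rw [thetaMinus, ← tsum_mul_left, ← tsum_mul_left, ← tsum_mul_left, ← tsum_mul_left]
  refine tsum_congr fun j => ?_
  have hexp : cexp (Real.pi * I * k * (u / τ) + Real.pi * I * (-1 / τ) * k ^ 2 / (κ : ℝ))
        * (cexp (Real.pi * I * (κ : ℝ) * w ^ 2 / τ)
          * jacobiTheta₂_term (j * κ + ν') w (τ / (κ : ℝ)))
      = cexp (Real.pi * I * κ * u ^ 2 / (4 * τ))
        * (cexp (-(2 * Real.pi * I / κ * (ν + 1 / 2) * (ν' + 1 / 2)))
          * thetaTerm (-1) ((ν' : ℝ) + 1 / 2) ((κ : ℝ) / 2) τ u j) := by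
    rw [thetaTerm, qPow, jacobiTheta₂_term, neg_one_zpow_eq_odd j ν]
    simp only [← Complex.exp_add]
    congr 1
    rw [hw, hkc]
    push_cast
    field_simp
    ring
  linear_combination ((-I * τ) ^ (1 / 2 : ℂ) / (Real.sqrt κ : ℂ)) * hexp

lemma thetaMinus_add_two (ν M : ℕ) (τ u : ℂ) :
    thetaMinus ((ν : ℝ) + 1 / 2) ((M : ℝ) / 2 + 1 / 2) τ (u + 2)
      = -thetaMinus ((ν : ℝ) + 1 / 2) ((M : ℝ) / 2 + 1 / 2) τ u := by
  rw [thetaMinus, thetaMinus, ← tsum_neg]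
  refine tsum_congr fun j => ?_
  have hM : (M : ℂ) + 1 ≠ 0 := by exact_mod_cast M.succ_ne_zero
  have h1 : cexp (2 * Real.pi * I * ((M : ℝ) / 2 + 1 / 2 : ℝ)
        * ((j : ℂ) + ((ν : ℝ) + 1 / 2 : ℝ) / (2 * ((M : ℝ) / 2 + 1 / 2 : ℝ))) * (u + 2))
      = -cexp (2 * Real.pi * I * ((M : ℝ) / 2 + 1 / 2 : ℝ)
        * ((j : ℂ) + ((ν : ℝ) + 1 / 2 : ℝ) / (2 * ((M : ℝ) / 2 + 1 / 2 : ℝ))) * u) := by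
    rw [← exp_add_pi_mul_I, Complex.exp_eq_exp_iff_exists_int]
    refine ⟨(M + 1) * j + ν, ?_⟩
    push_cast
    field_simp
    ring
  rw [thetaTerm, thetaTerm, h1]
  ring

/-- For M = 2r the q-exponent is r j² + j(j+1)/2 + νj plus the constant (ν+1/2)²/(2(M+1)); evenness
of M makes the rest an integer. -/
lemma thetaMinus_T (ν M : ℕ) (hM : Even M) (τ u : ℂ) :
    thetaMinus ((ν : ℝ) + 1 / 2) ((M : ℝ) / 2 + 1 / 2) (τ + 1) u
      = cexp (Real.pi * I / (M + 1) * ((ν : ℂ) + 1 / 2) ^ 2)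
        * thetaMinus ((ν : ℝ) + 1 / 2) ((M : ℝ) / 2 + 1 / 2) τ u := by
  rw [thetaMinus, thetaMinus, ← tsum_mul_left]
  refine tsum_congr fun j => ?_
  have hM1 : (M : ℂ) + 1 ≠ 0 := by exact_mod_cast M.succ_ne_zero
  obtain ⟨r, rfl⟩ := hM
  obtain ⟨s, hs⟩ := Int.even_mul_succ_self j
  have hs' : (j : ℂ) * (j + 1) = s + s := by exact_mod_cast hs
  have h1 : cexp (2 * Real.pi * I * ((((r + r : ℕ) : ℝ) / 2 + 1 / 2)
        * ((j : ℝ) + ((ν : ℝ) + 1 / 2) / (2 * (((r + r : ℕ) : ℝ) / 2 + 1 / 2))) ^ 2 : ℝ))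
      = cexp (Real.pi * I / ((r + r : ℕ) + 1) * ((ν : ℂ) + 1 / 2) ^ 2) := by
    rw [Complex.exp_eq_exp_iff_exists_int]
    refine ⟨r * j ^ 2 + s + ν * j, ?_⟩
    push_cast at hM1 ⊢
    have hs'' : (s : ℂ) = j * (j + 1) / 2 := by linear_combination -hs' / 2
    rw [show (r : ℂ) + r + 1 = 2 * r + 1 by ring] at hM1 ⊢
    rw [hs'', show ((r : ℂ) + r) / 2 + 1 / 2 = (2 * r + 1) / 2 by ring]
    field_simp
    ring
  rw [thetaTerm, thetaTerm, qPow_add_one, h1]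
  ring

/-! ### The product of theta series and reciprocal theta function -/

/-- The product of the theta series `θ^{(-)}_{ν+1/2,m+1/2}` with `m = M/2` and `invTheta`. -/
def psi (M ν : ℕ) (τ u : ℂ) : ℂ :=
  thetaMinus ((ν : ℝ) + 1 / 2) ((M : ℝ) / 2 + 1 / 2) τ u * invTheta τ u

lemma psi_add_two (M ν : ℕ) (τ u : ℂ) : psi M ν τ (u + 2) = psi M ν τ u := by
  rw [psi, psi, thetaMinus_add_two, invTheta_add_two, neg_mul_neg]

lemma psi_T (M ν : ℕ) (hM : Even M) (τ u : ℂ) :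
    psi M ν (τ + 1) u = cexp (Real.pi * I / (M + 1) * ((ν : ℂ) + 1 / 2) ^ 2) * psi M ν τ u := by
  rw [psi, psi, thetaMinus_T ν M hM, invTheta_T, mul_assoc]

/-- The weights 1/2 and 1 add up through (-iτ)^{1/2} τ = i(-iτ)^{3/2}, and the indices M+1 and -1 of
the Gaussian factors add up to M. -/
theorem psi_S {τ : ℂ} (hτ : 0 < τ.im) (M ν : ℕ) {u : ℂ} (hu : ¬ InLattice τ u) :
    psi M ν (-1 / τ) (u / τ)
      = I * (-I * τ) ^ (3 / 2 : ℂ) / (Real.sqrt (M + 1) : ℂ)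
        * cexp (Real.pi * I * M * u ^ 2 / (4 * τ))
        * ∑ ν' ∈ Finset.range (M + 1),
          cexp (-(2 * Real.pi * I / (M + 1) * (ν + 1 / 2) * (ν' + 1 / 2))) * psi M ν' τ u := by
  have h0 : τ ≠ 0 := fun h => by simp [h] at hτ
  have hS := thetaMinus_S hτ M.succ_pos ν u
  have hκ : ((M.succ : ℕ) : ℝ) / 2 = (M : ℝ) / 2 + 1 / 2 := by push_cast; ring
  have hκ' : ((M.succ : ℕ) : ℝ) = (M : ℝ) + 1 := by push_cast; ring
  have hκ'' : ((M.succ : ℕ) : ℂ) = (M : ℂ) + 1 := by push_cast; ring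
  have hpow : I * (-I * τ) ^ (3 / 2 : ℂ) = (-I * τ) ^ (1 / 2 : ℂ) * τ := by
    rw [show (3 / 2 : ℂ) = 1 / 2 + 1 by norm_num, Complex.cpow_add _ _ (by simp [h0]),
      Complex.cpow_one]
    linear_combination (-(-I * τ) ^ (1 / 2 : ℂ) * τ) * Complex.I_sq
  have hexp : cexp (Real.pi * I * M * u ^ 2 / (4 * τ))
      = cexp (Real.pi * I * (M + 1) * u ^ 2 / (4 * τ))
        * cexp (-(Real.pi * I * u ^ 2 / (4 * τ))) := by
    rw [← Complex.exp_add]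
    congr 1
    field_simp
    ring
  simp only [hκ] at hS
  simp only [hκ', hκ''] at hS
  have hsum : ∑ ν' ∈ Finset.range (M + 1),
        cexp (-(2 * Real.pi * I / (M + 1) * (ν + 1 / 2) * (ν' + 1 / 2))) * psi M ν' τ u
      = (∑ ν' ∈ Finset.range (M + 1),
        cexp (-(2 * Real.pi * I / (M + 1) * (ν + 1 / 2) * (ν' + 1 / 2)))
          * thetaMinus ((ν' : ℝ) + 1 / 2) ((M : ℝ) / 2 + 1 / 2) τ u) * invTheta τ u := by
    rw [Finset.sum_mul]
    exact Finset.sum_congr rfl fun _ _ => by rw [psi]; ring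
  rw [hsum, psi, hS, invTheta_S hτ hu, hpow, hexp]
  ring

/-! ### Poles, and telescoping of the Appell sums -/

/-- The condition that `z` avoids the poles of `G m n ν τ` for `m = M/2`. -/
def OffPoles (M : ℕ) (τ z : ℂ) : Prop := ∀ a b : ℤ, (M : ℂ) / 2 * z ≠ a + M * b * τ

lemma OffPoles.not_inLattice {M : ℕ} (hM : 0 < M) {τ z : ℂ} (hz : OffPoles M τ z) (l : ℤ) :
    ¬ InLattice τ (z + 2 * l / M) := by
  have hM0 : (M : ℂ) ≠ 0 := by exact_mod_cast hM.ne'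
  rintro ⟨a, b, h⟩
  refine hz (M * a - l) b ?_
  rw [← eq_sub_iff_add_eq] at h
  rw [h]
  push_cast
  field_simp
  ring

lemma OffPoles.nomePt_pow_ne_one {M : ℕ} {τ z : ℂ} (hz : OffPoles M τ z) (i : ℤ) :
    nomePt τ z i ^ M ≠ 1 := by
  intro h
  rw [nomePt, ← Complex.exp_nat_mul, Complex.exp_eq_one_iff] at h
  obtain ⟨a, ha⟩ := h
  have hpi : (Real.pi : ℂ) * I ≠ 0 := by simp [Real.pi_ne_zero]
  refine hz a (-i) ?_
  apply mul_left_cancel₀ hpi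
  push_cast
  linear_combination (1 / 2 : ℂ) * ha

section

variable {M : ℕ} {n ν : ℕ} {τ z : ℂ}

lemma hTerm_eq (M n ν : ℕ) (τ z : ℂ) (j : ℤ) :
    hTerm ((M : ℝ) / 2) n ν τ z j
      = thetaTerm 1 0 ((M : ℝ) / 2) τ z j * geomKernel n M (nomePt τ z (j + ν)) := by
  have h1 : cexp (2 * Real.pi * I * ((M : ℝ) / 2 : ℝ) * z)
      * qPow τ (2 * ((M : ℝ) / 2) * ((j : ℝ) + ν)) = nomePt τ z (j + ν) ^ M := by
    rw [nomePt, qPow, ← Complex.exp_nat_mul, ← Complex.exp_add]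
    congr 1
    push_cast
    ring
  have h2 : cexp (2 * Real.pi * I * ((M : ℝ) / 2 : ℝ) * j * z + Real.pi * I * n * z)
        * qPow τ ((M : ℝ) / 2 * (j : ℝ) ^ 2 + n * ((j : ℝ) + ν))
      = thetaTerm 1 0 ((M : ℝ) / 2) τ z j * nomePt τ z (j + ν) ^ n := by
    rw [thetaTerm, nomePt, qPow, qPow, ← Complex.exp_nat_mul, one_zpow, one_mul,
      ← Complex.exp_add, ← Complex.exp_add, ← Complex.exp_add]
    congr 1
    push_cast
    simp only [zero_div, add_zero]
    ring
  rw [hTerm, h1, h2, geomKernel, mul_div_assoc]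

lemma summable_thetaTerm_mul_geomKernel (hτ : 0 < τ.im) (hn : n < M) (z : ℂ) (N : ℤ) :
    Summable fun k : ℤ =>
      thetaTerm 1 0 ((M : ℝ) / 2) τ z k * geomKernel n M (nomePt τ z (k + N)) := by
  have hM : (0 : ℝ) < (M : ℝ) / 2 := by
    have : (0 : ℝ) < M := by exact_mod_cast (by omega : 0 < M)
    positivity
  obtain ⟨C, hC0, hC⟩ := exists_geomKernel_bound hτ z hn
  refine Summable.of_norm_bounded
    ((summable_thetaTerm norm_one 0 hM hτ z).norm.mul_right C) fun k => ?_
  rw [norm_mul]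
  exact mul_le_mul_of_nonneg_left (hC _) (norm_nonneg _)

lemma summable_hTerm (hτ : 0 < τ.im) (hn : n < M) (ν : ℕ) (z : ℂ) :
    Summable (hTerm ((M : ℝ) / 2) n ν τ z) := by
  refine (summable_thetaTerm_mul_geomKernel hτ hn z ν).congr fun j => ?_
  rw [hTerm_eq]

/-- The Appell-type function `q^{-mN^2} h_{n,N}` with `m = M/2`, for an arbitrary integer `N`. -/
def appell (M n : ℕ) (τ z : ℂ) (N : ℤ) : ℂ :=
  qPow τ (-((M : ℝ) / 2) * (N : ℝ) ^ 2) * ∑' k : ℤ,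
    thetaTerm 1 0 ((M : ℝ) / 2) τ z k * geomKernel n M (nomePt τ z (k + N))

lemma qPow_mul_h (M n ν : ℕ) (τ z : ℂ) :
    qPow τ (-((M : ℝ) / 2) * (ν : ℝ) ^ 2) * h ((M : ℝ) / 2) n ν τ z = appell M n τ z ν := by
  rw [h, appell, tsum_congr (hTerm_eq M n ν τ z)]
  simp

/-- Shifting k keeps x = `nomePt τ z (k + N)` fixed and multiplies the weight by x^M, so the
difference of the terms is x^n(1-x^M)/(1-x^M) = x^n times a Gaussian: a theta series remains. -/
lemma appell_succ (hτ : 0 < τ.im) (hn : n < M) (hz : OffPoles M τ z) (N : ℤ) :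
    appell M n τ z (N + 1) = appell M n τ z N + thetaPlus n ((M : ℝ) / 2) τ z
      * qPow τ (-((M : ℝ) / 2) * ((N : ℝ) + 1 - n / (2 * ((M : ℝ) / 2))) ^ 2) := by
  have hM : (0 : ℝ) < M := by exact_mod_cast (by omega : 0 < M)
  have hM0 : (M : ℂ) ≠ 0 := by exact_mod_cast hM.ne'
  have hshift := (Equiv.subRight (1 : ℤ)).tsum_eq fun k : ℤ =>
    thetaTerm 1 0 ((M : ℝ) / 2) τ z k * geomKernel n M (nomePt τ z (k + (N + 1)))
  have hshift2 := (Equiv.subRight (1 : ℤ)).tsum_eq (thetaTerm 1 n ((M : ℝ) / 2) τ z)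
  have key (k : ℤ) :
      qPow τ (-((M : ℝ) / 2) * ((N + 1 : ℤ) : ℝ) ^ 2) * (thetaTerm 1 0 ((M : ℝ) / 2) τ z (k - 1)
          * geomKernel n M (nomePt τ z (k + N)))
      = qPow τ (-((M : ℝ) / 2) * (N : ℝ) ^ 2) * (thetaTerm 1 0 ((M : ℝ) / 2) τ z k
          * geomKernel n M (nomePt τ z (k + N)))
        + thetaTerm 1 n ((M : ℝ) / 2) τ z (k - 1)
          * qPow τ (-((M : ℝ) / 2) * ((N : ℝ) + 1 - n / (2 * ((M : ℝ) / 2))) ^ 2) := by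
    have h1 : qPow τ (-((M : ℝ) / 2) * (N : ℝ) ^ 2) * thetaTerm 1 0 ((M : ℝ) / 2) τ z k
        = qPow τ (-((M : ℝ) / 2) * ((N + 1 : ℤ) : ℝ) ^ 2)
          * thetaTerm 1 0 ((M : ℝ) / 2) τ z (k - 1) * nomePt τ z (k + N) ^ M := by
      simp only [thetaTerm, nomePt, qPow, ← Complex.exp_nat_mul, one_zpow, one_mul,
        ← Complex.exp_add]
      congr 1
      push_cast
      simp only [zero_div, add_zero]
      ring
    have h2 : thetaTerm 1 n ((M : ℝ) / 2) τ z (k - 1)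
          * qPow τ (-((M : ℝ) / 2) * ((N : ℝ) + 1 - n / (2 * ((M : ℝ) / 2))) ^ 2)
        = qPow τ (-((M : ℝ) / 2) * ((N + 1 : ℤ) : ℝ) ^ 2)
          * thetaTerm 1 0 ((M : ℝ) / 2) τ z (k - 1) * nomePt τ z (k + N) ^ n := by
      simp only [thetaTerm, nomePt, qPow, ← Complex.exp_nat_mul, one_zpow, one_mul,
        ← Complex.exp_add]
      congr 1
      push_cast
      simp only [zero_div, add_zero]
      field_simp
      ring
    have h3 : 1 - nomePt τ z (k + N) ^ M ≠ 0 := sub_ne_zero.mpr (hz.nomePt_pow_ne_one _).symm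
    rw [h2, ← mul_assoc, ← mul_assoc, h1, geomKernel]
    field_simp
    ring
  have hθ := summable_thetaTerm (ε := 1) norm_one n (half_pos hM) hτ z
  rw [appell, appell, ← hshift, ← tsum_mul_left, thetaPlus, ← hshift2, ← tsum_mul_right,
    ← tsum_mul_left, ← Summable.tsum_add]
  · refine tsum_congr fun k => ?_
    simp only [Equiv.subRight_apply]
    rw [show k - 1 + (N + 1) = k + N by ring]
    exact key k
  · exact (summable_thetaTerm_mul_geomKernel hτ hn z N).mul_left _
  · exact ((Equiv.subRight (1 : ℤ)).summable_iff.mpr hθ).mul_right _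

/-! ### The indefinite theta series g as a signed sum -/

/-- The sum `Σ_{0<p≤j} w p - Σ_{j<p≤0} w p`. -/
def signedSum (w : ℤ → ℂ) (j : ℤ) : ℂ :=
  ∑ p ∈ Finset.Ioc 0 j, w p - ∑ p ∈ Finset.Ioc j 0, w p

lemma signedSum_zero (w : ℤ → ℂ) : signedSum w 0 = 0 := by simp [signedSum]

lemma signedSum_succ (w : ℤ → ℂ) (j : ℤ) : signedSum w (j + 1) = signedSum w j + w (j + 1) := by
  rcases le_or_gt 0 j with hj | hj
  · have h1 : Finset.Ioc 0 (j + 1) = insert (j + 1) (Finset.Ioc 0 j) := by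
      ext p
      simp only [Finset.mem_Ioc, Finset.mem_insert]
      omega
    rw [signedSum, signedSum, h1, Finset.sum_insert (by simp),
      Finset.Ioc_eq_empty_of_le (by omega : (0 : ℤ) ≤ j + 1), Finset.Ioc_eq_empty_of_le hj]
    simp [add_comm]
  · have h1 : Finset.Ioc j 0 = insert (j + 1) (Finset.Ioc (j + 1) 0) := by
      ext p
      simp only [Finset.mem_Ioc, Finset.mem_insert]
      omega
    rw [signedSum, signedSum, h1, Finset.sum_insert (by simp),
      Finset.Ioc_eq_empty_of_le (by omega : j + 1 ≤ 0), Finset.Ioc_eq_empty_of_le hj.le]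
    simp

/-- The factor of `gTerm` which depends on `p`. -/
def pWeight (m : ℝ) (n ν : ℕ) (τ : ℂ) (p : ℤ) : ℂ :=
  qPow τ (-m * ((p : ℝ) + ν - n / (2 * m)) ^ 2)

/-- The factor of `gTerm` which depends on `j`. -/
def jWeight (m : ℝ) (ν : ℕ) (τ : ℂ) (j : ℤ) : ℂ :=
  (-1) ^ j * qPow τ ((m + 1 / 2) * ((j : ℝ) + ν - ((ν : ℝ) + 1 / 2) / (2 * (m + 1 / 2))) ^ 2)

lemma gTerm_eq (m : ℝ) (n ν : ℕ) (τ : ℂ) (j p : ℤ) :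
    gTerm m n ν τ (j, p) = jWeight m ν τ j * pWeight m n ν τ p := by
  rw [gTerm, jWeight, pWeight, mul_assoc, ← qPow_add]
  congr 2
  ring

/-- Telescoping upwards from ν produces the cone 0 < p ≤ j, and downwards the cone j < p ≤ 0 with a
minus sign. -/
lemma appell_add (hτ : 0 < τ.im) (hn : n < M) (hz : OffPoles M τ z) (ν : ℕ) (j : ℤ) :
    appell M n τ z (j + ν) = appell M n τ z ν + thetaPlus n ((M : ℝ) / 2) τ z
      * signedSum (pWeight ((M : ℝ) / 2) n ν τ) j := by
  have step (i : ℤ) : appell M n τ z (i + 1 + ν) = appell M n τ z (i + ν)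
      + thetaPlus n ((M : ℝ) / 2) τ z * pWeight ((M : ℝ) / 2) n ν τ (i + 1) := by
    rw [show i + 1 + (ν : ℤ) = (i + ν) + 1 by ring, appell_succ hτ hn hz, pWeight]
    push_cast
    rw [show (i : ℝ) + ν + 1 = i + 1 + ν by ring]
  induction j using Int.induction_on with
  | zero => simp [signedSum_zero]
  | succ i ih => rw [step, ih, signedSum_succ]; ring
  | pred i ih =>
    have h1 := step (-(i : ℤ) - 1)
    have h2 := signedSum_succ (pWeight ((M : ℝ) / 2) n ν τ) (-(i : ℤ) - 1)
    rw [sub_add_cancel] at h1 h2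
    rw [h2, h1] at ih
    linear_combination ih

/-- On both cones p² ≤ j², so j²/2 ≥ j²/4 + p²/4 gives definiteness; the remaining terms are bounded
below by -mν². -/
lemma gExponent_bound {m n ν j p : ℝ} (hm : 0 < m) (hn : 0 ≤ n) (hnm : n ≤ 2 * m) (hν : 0 ≤ ν)
    (hjp : 0 ≤ p ∧ p ≤ j ∨ j + 1 ≤ p ∧ p ≤ 0) :
    j ^ 2 / 4 - j / 2 + p ^ 2 / 4 - (n ^ 2 / (4 * m) + m * ν ^ 2 + ν ^ 2 / 2 + ν / 2)
      ≤ (m + 1 / 2) * (j + ν - (ν + 1 / 2) / (2 * (m + 1 / 2))) ^ 2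
        - m * (p + ν - n / (2 * m)) ^ 2 := by
  have hexpand : (m + 1 / 2) * (j + ν - (ν + 1 / 2) / (2 * (m + 1 / 2))) ^ 2
        - m * (p + ν - n / (2 * m)) ^ 2
      = j ^ 2 / 2 - j / 2 - ν ^ 2 / 2 - ν / 2 + (ν + 1 / 2) ^ 2 / (2 * (2 * m + 1))
        - n ^ 2 / (4 * m) + (m * (j ^ 2 - p ^ 2) + 2 * m * ν * (j - p) + n * p + n * ν) := by
    have : m + 1 / 2 = (2 * m + 1) / 2 := by ring
    rw [this]
    field_simp
    ring
  have hpos : 0 ≤ (ν + 1 / 2) ^ 2 / (2 * (2 * m + 1)) := by positivity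
  have hp2 : p ^ 2 ≤ j ^ 2 := by
    rcases hjp with ⟨h1, h2⟩ | ⟨h1, h2⟩ <;> nlinarith
  have hmain : -(m * ν ^ 2) ≤ m * (j ^ 2 - p ^ 2) + 2 * m * ν * (j - p) + n * p + n * ν := by
    have hnν := mul_nonneg hn hν
    rcases hjp with ⟨h1, h2⟩ | ⟨h1, h2⟩
    · have e1 := mul_nonneg hm.le (sub_nonneg.mpr hp2)
      have e2 := mul_nonneg (mul_nonneg hm.le hν) (sub_nonneg.mpr h2)
      have e3 := mul_nonneg hn h1
      have e4 := mul_nonneg hm.le (sq_nonneg ν)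
      linarith
    -- With d = p - j ≥ 1 the terms other than nν equal m(d-ν)² - mν² + (2md-n)(-p), and n ≤ 2m ≤
    -- 2md.
    · have e1 := mul_nonneg hm.le (sq_nonneg (p - j - ν))
      have e2 : 0 ≤ (2 * m * (p - j) - n) * (-p) := by
        refine mul_nonneg ?_ (by linarith)
        nlinarith
      nlinarith
  rw [hexpand]
  linarith

lemma norm_gTerm (m : ℝ) (n ν : ℕ) (τ : ℂ) (x : ℤ × ℤ) :
    ‖gTerm m n ν τ x‖ = Real.exp (-(2 * Real.pi * τ.im *
      ((m + 1 / 2) * ((x.1 : ℝ) + ν - ((ν : ℝ) + 1 / 2) / (2 * (m + 1 / 2))) ^ 2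
        - m * ((x.2 : ℝ) + ν - n / (2 * m)) ^ 2))) := by
  rw [gTerm, norm_mul, norm_neg_one_zpow, one_mul, norm_qPow]

lemma summable_indicator_gTerm (hτ : 0 < τ.im) {m : ℝ} (hm : 0 < m) (hnm : (n : ℝ) ≤ 2 * m)
    (ν : ℕ) {s : Set (ℤ × ℤ)}
    (hs : ∀ x ∈ s, 0 ≤ x.2 ∧ x.2 ≤ x.1 ∨ x.1 + 1 ≤ x.2 ∧ x.2 ≤ 0) :
    Summable (s.indicator (gTerm m n ν τ)) := by
  have hpi := Real.pi_pos
  set D : ℝ := (n : ℝ) ^ 2 / (4 * m) + m * (ν : ℝ) ^ 2 + (ν : ℝ) ^ 2 / 2 + (ν : ℝ) / 2 with hD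
  have h1 := summable_exp_quadratic (A := 2 * Real.pi * τ.im / 4) (by positivity)
    (2 * Real.pi * τ.im / 2) (2 * Real.pi * τ.im * D)
  have h2 := summable_exp_quadratic (A := 2 * Real.pi * τ.im / 4) (by positivity) 0 0
  have h3 := h1.mul_of_nonneg h2 (fun _ => (Real.exp_pos _).le) (fun _ => (Real.exp_pos _).le)
  refine Summable.of_norm_bounded h3 fun x => ?_
  by_cases hx : x ∈ s
  · have hx' : (0 : ℝ) ≤ (x.2 : ℝ) ∧ (x.2 : ℝ) ≤ x.1 ∨ (x.1 : ℝ) + 1 ≤ x.2 ∧ (x.2 : ℝ) ≤ 0 := by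
      exact_mod_cast hs x hx
    have hb := gExponent_bound (ν := (ν : ℝ)) hm (Nat.cast_nonneg n) hnm (Nat.cast_nonneg ν) hx'
    rw [Set.indicator_of_mem hx, norm_gTerm, ← Real.exp_add]
    refine Real.exp_le_exp.mpr ?_
    have hb' := mul_le_mul_of_nonneg_left hb (by positivity : 0 ≤ 2 * Real.pi * τ.im)
    rw [← hD] at hb'
    linarith
  · rw [Set.indicator_of_notMem hx, norm_zero]
    positivity

lemma conePos_bound (x : ℤ × ℤ) (hx : x ∈ conePos) :
    0 ≤ x.2 ∧ x.2 ≤ x.1 ∨ x.1 + 1 ≤ x.2 ∧ x.2 ≤ 0 := Or.inl ⟨hx.1.le, hx.2⟩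

lemma coneNeg_bound (x : ℤ × ℤ) (hx : x ∈ coneNeg) :
    0 ≤ x.2 ∧ x.2 ≤ x.1 ∨ x.1 + 1 ≤ x.2 ∧ x.2 ≤ 0 := Or.inr ⟨hx.1, hx.2⟩

lemma tsum_indicator_cone (f : ℤ × ℤ → ℂ) (j : ℤ) :
    ∑' p : ℤ, (conePos.indicator f (j, p) - coneNeg.indicator f (j, p))
      = signedSum (fun p => f (j, p)) j := by
  rw [signedSum, tsum_eq_sum (s := Finset.Ioc 0 j ∪ Finset.Ioc j 0), Finset.sum_sub_distrib]
  · congr 1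
    · rw [← Finset.sum_subset Finset.subset_union_left]
      · refine Finset.sum_congr rfl fun p hp => Set.indicator_of_mem ?_ _
        simpa [conePos] using hp
      · intro p _ hp
        exact Set.indicator_of_notMem (by simpa [conePos] using hp) _
    · rw [← Finset.sum_subset Finset.subset_union_right]
      · refine Finset.sum_congr rfl fun p hp => Set.indicator_of_mem ?_ _
        simpa [coneNeg] using hp
      · intro p _ hp
        exact Set.indicator_of_notMem (by simpa [coneNeg] using hp) _
  · intro p hp
    rw [Finset.mem_union, not_or] at hp
    rw [Set.indicator_of_notMem (by simpa [conePos] using hp.1),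
      Set.indicator_of_notMem (by simpa [coneNeg] using hp.2), sub_zero]

lemma signedSum_mul_left (c : ℂ) (w : ℤ → ℂ) (j : ℤ) :
    signedSum (fun p => c * w p) j = c * signedSum w j := by
  rw [signedSum, signedSum, mul_sub, Finset.mul_sum, Finset.mul_sum]

/-- Absolute convergence permits summation by rows, and each row is a finite signed sum. -/
lemma hasSum_g (hτ : 0 < τ.im) {m : ℝ} (hm : 0 < m) (hnm : (n : ℝ) ≤ 2 * m) (ν : ℕ) :
    HasSum (fun j : ℤ => jWeight m ν τ j * signedSum (pWeight m n ν τ) j) (g m n ν τ) := by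
  have h1 := summable_indicator_gTerm hτ hm hnm ν conePos_bound
  have h2 := summable_indicator_gTerm hτ hm hnm ν coneNeg_bound
  have h3 := h1.sub h2
  have h4 (j : ℤ) : ∑' p : ℤ, (conePos.indicator (gTerm m n ν τ) (j, p)
        - coneNeg.indicator (gTerm m n ν τ) (j, p))
      = jWeight m ν τ j * signedSum (pWeight m n ν τ) j := by
    rw [tsum_indicator_cone, ← signedSum_mul_left]
    simp_rw [gTerm_eq]
  have h5 : g m n ν τ = ∑' x, (conePos.indicator (gTerm m n ν τ) x
      - coneNeg.indicator (gTerm m n ν τ) x) := by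
    rw [h1.tsum_sub h2, g, tsum_subtype, tsum_subtype]
  have h6 := h3.prod
  simp only [h4] at h6
  rw [h5, h3.tsum_prod]
  simp only [h4]
  exact h6.hasSum

lemma thetaTerm_neg (m : ℝ) (ν : ℕ) (τ : ℂ) (j : ℤ) :
    thetaTerm (-1) ((ν : ℝ) + 1 / 2) (m + 1 / 2) τ 0 (-(j + ν)) = (-1) ^ ν * jWeight m ν τ j := by
  have hs : (-1 : ℂ) ^ (-(j + (ν : ℤ))) = (-1) ^ ν * (-1) ^ j := by
    rw [zpow_neg, ← inv_zpow, zpow_add₀ (by norm_num), zpow_natCast]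
    norm_num
    ring
  have hsq : ((-(j + (ν : ℤ)) : ℤ) : ℝ) + ((ν : ℝ) + 1 / 2) / (2 * (m + 1 / 2))
      = -((j : ℝ) + ν - ((ν : ℝ) + 1 / 2) / (2 * (m + 1 / 2))) := by
    push_cast
    ring
  rw [thetaTerm, jWeight, hs, hsq, mul_zero, Complex.exp_zero, mul_one, neg_sq, mul_assoc]

lemma hasSum_jWeight (hτ : 0 < τ.im) {m : ℝ} (hm : 0 < m) (ν : ℕ) :
    HasSum (jWeight m ν τ) ((-1) ^ ν * thetaMinus ((ν : ℝ) + 1 / 2) (m + 1 / 2) τ 0) := by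
  have hsum := summable_thetaTerm (ε := -1) (by simp) ((ν : ℝ) + 1 / 2)
    (by positivity : 0 < m + 1 / 2) hτ 0
  have h1 := hsum.hasSum
  rw [← ((Equiv.addRight (ν : ℤ)).trans (Equiv.neg ℤ)).hasSum_iff] at h1
  refine (h1.mul_left ((-1) ^ ν)).congr_fun fun j => ?_
  simp only [Function.comp_apply, Equiv.trans_apply, Equiv.neg_apply, Equiv.coe_addRight]
  rw [thetaTerm_neg, ← mul_assoc, ← mul_pow]
  norm_num

/-! ### G as a finite Fourier component of `psi` -/

/-- In `appell_add` the signed sums assemble to g θ, while the constant term is multiplied by the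
total mass of the weights, the theta value at z = 0. -/
lemma G_eq_tsum_appell (hτ : 0 < τ.im) (hn : n < M) (hz : OffPoles M τ z) (ν : ℕ) :
    G ((M : ℝ) / 2) n ν τ z
      = ∑' j : ℤ, jWeight ((M : ℝ) / 2) ν τ j * appell M n τ z (j + ν) := by
  have hM : (0 : ℝ) < (M : ℝ) / 2 := by
    have : (0 : ℝ) < M := by exact_mod_cast (by omega : 0 < M)
    positivity
  have hnm : (n : ℝ) ≤ 2 * ((M : ℝ) / 2) := by
    rw [mul_div_cancel₀ _ (by norm_num)]
    exact_mod_cast hn.le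
  have h1 := (hasSum_g hτ hM hnm ν).mul_right (thetaPlus n ((M : ℝ) / 2) τ z)
  have h2 := (hasSum_jWeight hτ hM ν).mul_right (appell M n τ z ν)
  have h3 := h1.add h2
  rw [G, mul_assoc, mul_assoc ((-1 : ℂ) ^ ν), mul_left_comm (qPow _ _), qPow_mul_h, ← mul_assoc,
    ← h3.tsum_eq]
  refine tsum_congr fun j => ?_
  rw [appell_add hτ hn hz]
  ring

/-- The terms (M/2)J² cancel, leaving J²/2 - (ν+1/2)J = J(J+1)/2 - (ν+1)J and a constant. -/
lemma jWeight_mul_qPow (M ν : ℕ) (τ : ℂ) (J : ℤ) :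
    jWeight ((M : ℝ) / 2) ν τ (J - ν) * qPow τ (-((M : ℝ) / 2) * (J : ℝ) ^ 2)
      = (-1) ^ ν * qPow τ (((ν : ℝ) + 1 / 2) ^ 2 / (2 * (M + 1))) * poleWeight τ (ν + 1) J := by
  have hs : (-1 : ℂ) ^ (J - (ν : ℤ)) = (-1) ^ ν * (-1) ^ J := by
    rw [zpow_sub₀ (by norm_num), zpow_natCast, div_eq_mul_inv, ← inv_pow]
    norm_num
    ring
  rw [jWeight, poleWeight, hs, mul_assoc, ← qPow_add, mul_mul_mul_comm, ← qPow_add]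
  congr 2
  have : (M : ℝ) / 2 + 1 / 2 = (M + 1) / 2 := by ring
  rw [this]
  push_cast
  field_simp
  ring

lemma G_eq_tsum_tsum (hτ : 0 < τ.im) (hn : n < M) (hz : OffPoles M τ z) (ν : ℕ) :
    G ((M : ℝ) / 2) n ν τ z
      = (-1) ^ ν * qPow τ (((ν : ℝ) + 1 / 2) ^ 2 / (2 * (M + 1)))
        * ∑' k : ℤ, thetaTerm 1 0 ((M : ℝ) / 2) τ z k
          * ∑' J : ℤ, poleWeight τ (ν + 1) J * geomKernel n M (nomePt τ z (k + J)) := by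
  have hM : (0 : ℝ) < (M : ℝ) / 2 := by
    have : (0 : ℝ) < M := by exact_mod_cast (by omega : 0 < M)
    positivity
  obtain ⟨C, hC0, hC⟩ := exists_geomKernel_bound hτ z hn
  have hs : Summable (Function.uncurry fun J k : ℤ => poleWeight τ (ν + 1) J
      * (thetaTerm 1 0 ((M : ℝ) / 2) τ z k * geomKernel n M (nomePt τ z (k + J)))) := by
    have h1 := (summable_norm_poleWeight hτ (ν + 1)).mul_of_nonneg
      ((summable_thetaTerm (ε := 1) norm_one 0 hM hτ z).norm.mul_right C)
      (fun _ => norm_nonneg _) (fun _ => by positivity)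
    refine Summable.of_norm_bounded h1 fun x => ?_
    rw [Function.uncurry, norm_mul, norm_mul]
    gcongr
    exact hC _
  rw [G_eq_tsum_appell hτ hn hz, ← (Equiv.subRight (ν : ℤ)).tsum_eq]
  have h2 (J : ℤ) : jWeight ((M : ℝ) / 2) ν τ (Equiv.subRight (ν : ℤ) J)
        * appell M n τ z (Equiv.subRight (ν : ℤ) J + ν)
      = (-1) ^ ν * qPow τ (((ν : ℝ) + 1 / 2) ^ 2 / (2 * (M + 1)))
        * ∑' k : ℤ, poleWeight τ (ν + 1) J
          * (thetaTerm 1 0 ((M : ℝ) / 2) τ z k * geomKernel n M (nomePt τ z (k + J))) := by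
    rw [Equiv.subRight_apply, sub_add_cancel, appell, ← mul_assoc, jWeight_mul_qPow,
      tsum_mul_left, mul_assoc]
  rw [tsum_congr h2, tsum_mul_left, ← hs.tsum_comm]
  congr 1
  refine tsum_congr fun k => ?_
  rw [← tsum_mul_left]
  exact tsum_congr fun J => by ring

lemma rootPow_mul_nomePt {M : ℕ} (hM : 0 < M) (τ z : ℂ) (l i : ℤ) :
    rootPow M l * nomePt τ z i = nomePt τ (z + 2 * l / M) i := by
  have hM0 : (M : ℂ) ≠ 0 := by exact_mod_cast hM.ne'
  rw [rootPow, nomePt, nomePt, ← Complex.exp_add]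
  congr 1
  field_simp
  ring

/-- The k²/2 coming from the inner sum raises the degree from M/2 to (M+1)/2 = m + 1/2. -/
lemma thetaTerm_mul_eq {M : ℕ} (hM : 0 < M) (ν : ℕ) (τ z : ℂ) (l k : ℤ) :
    qPow τ (((ν : ℝ) + 1 / 2) ^ 2 / (2 * (M + 1))) * thetaTerm 1 0 ((M : ℝ) / 2) τ z k
        * ((-1) ^ k * qPow τ ((k : ℝ) * (k - 1) / 2 + ((ν + 1 : ℤ) : ℝ) * k)
          * cexp (Real.pi * I * ((ν + 1 : ℤ) + k) * (z + 2 * l / M)))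
      = thetaTerm (-1) ((ν : ℝ) + 1 / 2) ((M : ℝ) / 2 + 1 / 2) τ (z + 2 * l / M) k
        * cexp (Real.pi * I * (z + 2 * l / M) / 2) := by
  have hM0 : (M : ℂ) ≠ 0 := by exact_mod_cast hM.ne'
  have hM1 : (M : ℂ) + 1 ≠ 0 := by exact_mod_cast M.succ_ne_zero
  -- Translation by 2l/M changes this exponent by 2πikl only.
  have hperiod : cexp (Real.pi * I * M * k * z)
      = cexp (Real.pi * I * M * k * (z + 2 * l / M)) := by
    rw [Complex.exp_eq_exp_iff_exists_int]
    exact ⟨-(k * l), by push_cast; field_simp; ring⟩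
  have h1 : thetaTerm 1 0 ((M : ℝ) / 2) τ z k
      = cexp (Real.pi * I * M * k * (z + 2 * l / M)) * qPow τ ((M : ℝ) / 2 * (k : ℝ) ^ 2) := by
    rw [← hperiod, thetaTerm, one_zpow, one_mul]
    congr 2
    · push_cast
      simp only [zero_div, add_zero]
      ring
    · simp
  rw [h1, thetaTerm, neg_one_zpow_eq]
  simp only [qPow, ← Complex.exp_add]
  congr 1
  push_cast
  rw [show (M : ℂ) / 2 + 1 / 2 = (M + 1) / 2 by ring]
  generalize z + 2 * l / M = u
  field_simp
  ring

/-- Partial fractions split the inner sum into translates by 2l/M, each a multiple of `poleSeries τ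
0`; that factor leaves the sum over k, and the rest is a theta series at the same translate. -/
theorem G_eq_sum_psi (hτ : 0 < τ.im) (hn : n < M) (hz : OffPoles M τ z) (ν : ℕ) :
    G ((M : ℝ) / 2) n ν τ z = (-1) ^ ν * (1 / M)
      * ∑ l ∈ Finset.range M, rootPow M (-(n * l)) * psi M ν τ (z + 2 * l / M) := by
  have hM : 0 < M := by omega
  have hM2 : (0 : ℝ) < (M : ℝ) / 2 + 1 / 2 := by positivity
  have hlat (l : ℕ) : ¬ InLattice τ (z + 2 * l / M) := by
    have := hz.not_inLattice hM l
    rwa [Int.cast_natCast] at this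
  have hinner (k : ℤ) :
      ∑' J : ℤ, poleWeight τ (ν + 1) J * geomKernel n M (nomePt τ z (k + J))
      = 1 / M * ∑ l ∈ Finset.range M, rootPow M (-(n * l))
        * ((-1) ^ k * qPow τ ((k : ℝ) * (k - 1) / 2 + ((ν + 1 : ℤ) : ℝ) * k)
          * (cexp (Real.pi * I * ((ν + 1 : ℤ) + k) * (z + 2 * l / M))
            * poleSeries τ 0 (z + 2 * l / M))) := by
    have h1 (J : ℤ) : poleWeight τ (ν + 1) J * geomKernel n M (nomePt τ z (k + J))
        = 1 / M * ∑ l ∈ Finset.range M, rootPow M (-(n * l))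
          * (poleWeight τ (ν + 1) J * (1 - nomePt τ (z + 2 * l / M) (k + J))⁻¹) := by
      rw [geomKernel_eq_sum hn (hz.nomePt_pow_ne_one _), mul_left_comm, Finset.mul_sum]
      congr 1
      refine Finset.sum_congr rfl fun l _ => ?_
      rw [rootPow_mul_nomePt hM, mul_left_comm]
      simp
    have h2 (l : ℕ) : Summable fun J : ℤ =>
        poleWeight τ (ν + 1) J * (1 - nomePt τ (z + 2 * l / M) (k + J))⁻¹ := by
      obtain ⟨C, hC0, hC⟩ := exists_geomKernel_bound hτ (z + 2 * l / M) (n := 0) (M := 1) one_pos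
      refine Summable.of_norm_bounded
        ((summable_norm_poleWeight hτ (ν + 1)).mul_right C) fun J => ?_
      rw [norm_mul, inv_one_sub_eq]
      exact mul_le_mul_of_nonneg_left (hC _) (norm_nonneg _)
    rw [tsum_congr h1, tsum_mul_left, Summable.tsum_finsetSum fun l _ => (h2 l).mul_left _]
    congr 1
    refine Finset.sum_congr rfl fun l _ => ?_
    rw [tsum_mul_left, tsum_poleWeight_shift hτ (hlat l)]
  have houter (k : ℤ) : qPow τ (((ν : ℝ) + 1 / 2) ^ 2 / (2 * (M + 1)))
        * (thetaTerm 1 0 ((M : ℝ) / 2) τ z k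
        * ∑' J : ℤ, poleWeight τ (ν + 1) J * geomKernel n M (nomePt τ z (k + J)))
      = 1 / M * ∑ l ∈ Finset.range M, rootPow M (-(n * l)) * invTheta τ (z + 2 * l / M)
        * thetaTerm (-1) ((ν : ℝ) + 1 / 2) ((M : ℝ) / 2 + 1 / 2) τ (z + 2 * l / M) k := by
    rw [hinner, Finset.mul_sum, Finset.mul_sum, Finset.mul_sum, Finset.mul_sum]
    refine Finset.sum_congr rfl fun l _ => ?_
    have := thetaTerm_mul_eq hM ν τ z l k
    rw [invTheta]
    push_cast at this ⊢
    linear_combination (1 / M * rootPow M (-(n * l)) * poleSeries τ 0 (z + 2 * l / M)) * this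
  have hθ (l : ℕ) := (summable_thetaTerm (ε := -1) (by simp) ((ν : ℝ) + 1 / 2) hM2 hτ
    (z + 2 * l / M)).mul_left (rootPow M (-(n * l)) * invTheta τ (z + 2 * l / M))
  rw [G_eq_tsum_tsum hτ hn hz, mul_assoc, ← tsum_mul_left, tsum_congr houter, tsum_mul_left,
    Summable.tsum_finsetSum fun l _ => hθ l, mul_assoc]
  congr 2
  refine Finset.sum_congr rfl fun l _ => ?_
  rw [tsum_mul_left, psi, thetaMinus]
  ring

end

/-! ### Fourier inversion and the transformation laws of G -/

lemma rootPow_neg_mul_periodic {M : ℕ} (hM : 0 < M) (n : ℕ) (l : ℤ) :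
    rootPow M (-(n * (l + M))) = rootPow M (-(n * l)) := by
  have hM0 : (M : ℂ) ≠ 0 := by exact_mod_cast hM.ne'
  rw [rootPow, rootPow, Complex.exp_eq_exp_iff_exists_int]
  exact ⟨-n, by push_cast; field_simp; ring⟩

/-- Summing the Fourier components over n leaves only the translate l = 0. -/
lemma psi_eq_sum_G {M : ℕ} (hM : 0 < M) {τ z : ℂ} (hτ : 0 < τ.im) (hz : OffPoles M τ z) (ν : ℕ) :
    psi M ν τ z = (-1) ^ ν * ∑ n ∈ Finset.range M, G ((M : ℝ) / 2) n ν τ z := by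
  have hM0 : (M : ℂ) ≠ 0 := by exact_mod_cast hM.ne'
  have h1 : ∀ n ∈ Finset.range M, G ((M : ℝ) / 2) n ν τ z = (-1) ^ ν * (1 / M)
      * ∑ l ∈ Finset.range M, rootPow M (-(n * l)) * psi M ν τ (z + 2 * l / M) :=
    fun n hn => G_eq_sum_psi hτ (Finset.mem_range.mp hn) hz ν
  have h2 (l : ℕ) : ∑ n ∈ Finset.range M, rootPow M (-(n * l))
      = if (M : ℤ) ∣ -l then (M : ℂ) else 0 := by
    rw [← sum_rootPow_mul hM]
    exact Finset.sum_congr rfl fun n _ => by rw [neg_mul, mul_comm]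
  rw [Finset.sum_congr rfl h1, ← Finset.mul_sum, Finset.sum_comm]
  simp_rw [← Finset.sum_mul, h2]
  rw [Finset.sum_eq_single_of_mem 0 (Finset.mem_range.mpr hM)]
  · have h3 : ((-1 : ℂ) ^ ν) * (-1) ^ ν = 1 := by
      rw [← mul_pow]
      norm_num
    simp only [Nat.cast_zero, neg_zero, dvd_zero, if_true, mul_zero, zero_div, add_zero]
    field_simp
    linear_combination (-psi M ν τ z) * h3
  · intro l hl hl0
    rw [if_neg, zero_mul]
    rw [dvd_neg, Int.natCast_dvd_natCast]
    exact fun h => hl0 (Nat.eq_zero_of_dvd_of_lt h (Finset.mem_range.mp hl))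

lemma sum_zmod_val (M : ℕ) [NeZero M] (φ : ℕ → ℂ) :
    ∑ c : ZMod M, φ c.val = ∑ l ∈ Finset.range M, φ l := by
  obtain ⟨k, rfl⟩ := Nat.exists_eq_succ_of_ne_zero (NeZero.ne M)
  exact Fin.sum_univ_eq_sum_range φ (k + 1)

/-- The sign is needed because the argument z - ℓτ/m, divided by τ, is a translate by -2ℓ/M. -/
lemma sum_neg_representatives {M : ℕ} [NeZero M] {φ : ℤ → ℂ} (hφ : ∀ l, φ (l + M) = φ l)
    (r : ZMod M → ℤ) (hr : ∀ c, (r c : ZMod M) = c) :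
    ∑ c, φ (-r c) = ∑ l ∈ Finset.range M, φ l := by
  have hper : Function.Periodic φ (M : ℤ) := hφ
  have hmod {a b : ℤ} (hab : (a : ZMod M) = b) : φ a = φ b := by
    rw [ZMod.intCast_eq_intCast_iff_dvd_sub] at hab
    obtain ⟨k, hk⟩ := hab
    have := (hper.int_mul k) a
    rw [← this]
    congr 1
    push_cast
    linarith
  rw [← sum_zmod_val M fun l => φ l, ← Equiv.sum_comp (Equiv.neg (ZMod M))]
  refine Finset.sum_congr rfl fun c _ => hmod ?_
  rw [Int.cast_neg, hr]
  simp

/-- For fixed l, the sum over n' collapses G to `psi`, the sum over ν' is then `psi_S`, and the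
exponentials in z complete the square to a Gaussian in u = z - 2lτ/M. -/
lemma sum_sTerm {M : ℕ} (hM : 0 < M) {τ z : ℂ} (hτ : 0 < τ.im)
    (hz : ∀ a b : ℤ, (M : ℂ) / 2 * z ≠ a + b * τ) (n ν : ℕ) (l : ℤ) :
    I * (-I * τ) ^ (3 / 2 : ℂ) / (Real.sqrt (M + 1) : ℂ)
        * ∑ n' ∈ Finset.range M, ∑ ν' ∈ Finset.range (M + 1),
          sTerm ((M : ℝ) / 2) n ν τ z n' ν' l
      = (-1) ^ ν * (rootPow M (-(n * (-l : ℤ)))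
        * psi M ν (-1 / τ) (z / τ + 2 * (-l : ℤ) / M)) := by
  have h0 : τ ≠ 0 := fun h => by simp [h] at hτ
  have hM0 : (M : ℂ) ≠ 0 := by exact_mod_cast hM.ne'
  have hM1 : (M : ℂ) + 1 ≠ 0 := by exact_mod_cast M.succ_ne_zero
  set u : ℂ := z - l * τ / ((M : ℝ) / 2 : ℝ) with hu
  have hu' : u = z - 2 * l * τ / M := by
    rw [hu]
    push_cast
    field_simp
  -- Since (M/2)u = (M/2)z - lτ, avoiding all of ℤ + τℤ is what covers every l.
  have hoff : OffPoles M τ u := by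
    intro a b h
    refine hz a (M * b + l) ?_
    rw [hu'] at h
    push_cast
    field_simp at h ⊢
    linear_combination h
  have hlat : ¬ InLattice τ u := by simpa using hoff.not_inLattice hM 0
  have harg : z / τ + 2 * (-l : ℤ) / M = u / τ := by
    rw [hu']
    push_cast
    field_simp
    ring
  have hterm (n' ν' : ℕ) : sTerm ((M : ℝ) / 2) n ν τ z n' ν' l
      = (-1) ^ ν * rootPow M (-(n * (-l : ℤ))) * cexp (Real.pi * I * M * u ^ 2 / (4 * τ))
        * (cexp (-(2 * Real.pi * I / (M + 1) * (ν + 1 / 2) * (ν' + 1 / 2)))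
          * ((-1) ^ ν' * G ((M : ℝ) / 2) n' ν' τ u)) := by
    have e1 : cexp (Real.pi * I * n * l / ((M : ℝ) / 2 : ℝ)) = rootPow M (-(n * (-l : ℤ))) := by
      rw [rootPow]
      congr 1
      push_cast
      field_simp
    have e2 : cexp (-(Real.pi * I / (((M : ℝ) / 2 : ℝ) + 1 / 2) * (ν + 1 / 2) * (ν' + 1 / 2)))
        = cexp (-(2 * Real.pi * I / (M + 1) * (ν + 1 / 2) * (ν' + 1 / 2))) := by
      congr 1
      push_cast
      rw [show (M : ℂ) / 2 + 1 / 2 = (M + 1) / 2 by ring]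
      field_simp
    have e3 : cexp (Real.pi * I * ((M : ℝ) / 2 : ℝ) / (2 * τ) * z ^ 2)
        * cexp (-(Real.pi * I * l * z)) * qPow τ ((l : ℝ) ^ 2 / (4 * ((M : ℝ) / 2)))
        = cexp (Real.pi * I * M * u ^ 2 / (4 * τ)) := by
      rw [qPow, ← Complex.exp_add, ← Complex.exp_add, hu']
      congr 1
      push_cast
      field_simp
      ring
    rw [sTerm, e1, e2, ← e3, pow_add, ← hu]
    ring
  have hsum : ∑ n' ∈ Finset.range M, ∑ ν' ∈ Finset.range (M + 1),
        sTerm ((M : ℝ) / 2) n ν τ z n' ν' l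
      = (-1) ^ ν * rootPow M (-(n * (-l : ℤ))) * cexp (Real.pi * I * M * u ^ 2 / (4 * τ))
        * ∑ ν' ∈ Finset.range (M + 1),
          cexp (-(2 * Real.pi * I / (M + 1) * (ν + 1 / 2) * (ν' + 1 / 2))) * psi M ν' τ u := by
    simp_rw [hterm]
    rw [Finset.sum_comm]
    simp_rw [← Finset.mul_sum]
    congr 1
    exact Finset.sum_congr rfl fun ν' _ => by rw [psi_eq_sum_G hM hτ hoff]
  rw [hsum, harg, psi_S hτ M ν hlat]
  ring

theorem G_S {M : ℕ} [NeZero M] {n : ℕ} (hn : n < M) (ν : ℕ) {τ z : ℂ} (hτ : 0 < τ.im)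
    (hz : ∀ a b : ℤ, (M : ℂ) / 2 * z ≠ a + b * τ) (r : ZMod M → ℤ)
    (hr : ∀ c : ZMod M, (r c : ZMod M) = c) :
    G ((M : ℝ) / 2) n ν (-1 / τ) (z / τ)
      = I * (-I * τ) ^ (3 / 2 : ℂ) / (M * (Real.sqrt (M + 1) : ℂ))
        * ∑ n' ∈ Finset.range M, ∑ ν' ∈ Finset.range (M + 1), ∑ c : ZMod M,
          sTerm ((M : ℝ) / 2) n ν τ z n' ν' (r c) := by
  have hM : 0 < M := by omega
  have h0 : τ ≠ 0 := fun h => by simp [h] at hτ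
  have hM0 : (M : ℂ) ≠ 0 := by exact_mod_cast hM.ne'
  have hoff : OffPoles M (-1 / τ) (z / τ) := by
    intro a b h
    refine hz (-(M * b)) a ?_
    push_cast
    field_simp at h ⊢
    linear_combination h
  have hper (l : ℤ) : rootPow M (-(n * (l + M))) * psi M ν (-1 / τ) (z / τ + 2 * (l + M : ℤ) / M)
      = rootPow M (-(n * l)) * psi M ν (-1 / τ) (z / τ + 2 * l / M) := by
    rw [rootPow_neg_mul_periodic hM, ← psi_add_two M ν (-1 / τ) (z / τ + 2 * l / M)]
    congr 2
    push_cast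
    field_simp
    ring
  have hrep := sum_neg_representatives
    (φ := fun l => rootPow M (-(n * l)) * psi M ν (-1 / τ) (z / τ + 2 * l / M)) hper r hr
  have hswap : ∑ n' ∈ Finset.range M, ∑ ν' ∈ Finset.range (M + 1), ∑ c : ZMod M,
        sTerm ((M : ℝ) / 2) n ν τ z n' ν' (r c)
      = ∑ c : ZMod M, ∑ n' ∈ Finset.range M, ∑ ν' ∈ Finset.range (M + 1),
        sTerm ((M : ℝ) / 2) n ν τ z n' ν' (r c) :=
    (Finset.sum_congr rfl fun n' _ => Finset.sum_comm).trans Finset.sum_comm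
  have hG := G_eq_sum_psi (im_neg_one_div hτ) hn hoff ν
  simp only [Int.cast_natCast] at hrep
  have hS := Finset.sum_congr (rfl : (Finset.univ : Finset (ZMod M)) = Finset.univ)
    fun c _ => sum_sTerm hM hτ hz n ν (r c)
  rw [← Finset.mul_sum, ← Finset.mul_sum] at hS
  rw [hG, ← hrep, hswap, mul_comm (M : ℂ), ← div_div, div_mul_eq_mul_div, hS]
  ring

theorem G_T {M : ℕ} {n : ℕ} (hn : n < M) (hM : Even M) (ν : ℕ) {τ z : ℂ} (hτ : 0 < τ.im)
    (hz : OffPoles M τ z) :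
    G ((M : ℝ) / 2) n ν (τ + 1) z
      = cexp (Real.pi * I / (M + 1) * ((ν : ℂ) + 1 / 2) ^ 2) * G ((M : ℝ) / 2) n ν τ z := by
  have hoff : OffPoles M (τ + 1) z := fun a b h =>
    hz (a + M * b) b (by rw [h]; push_cast; ring)
  rw [G_eq_sum_psi (by simpa using hτ) hn hoff, G_eq_sum_psi hτ hn hz, mul_left_comm,
    Finset.mul_sum _ _ (cexp _)]
  congr 1
  exact Finset.sum_congr rfl fun l _ => by rw [psi_T M ν hM]; ring

end IndefiniteModular

end

theorem mainTheorem4 (m : ℝ) (M : ℕ) [NeZero M] (hm : m = (M : ℝ) / 2)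
    (n ν : ℕ) (hn : n < M) (hν : ν ≤ M) (τ : ℂ) (hτ : 0 < τ.im) :
    -- every series in the definition of `G m n ν τ z` converges absolutely off the poles
    ((Summable fun x : IndefiniteModular.conePos => IndefiniteModular.gTerm m n ν τ x) ∧
      (Summable fun x : IndefiniteModular.coneNeg => IndefiniteModular.gTerm m n ν τ x) ∧
      Summable (IndefiniteModular.thetaTerm (-1) ((ν : ℝ) + 1 / 2) (m + 1 / 2) τ 0) ∧
      ∀ z : ℂ, (∀ a b : ℤ, (m : ℂ) * z ≠ a + 2 * m * b * τ) →
        Summable (IndefiniteModular.thetaTerm 1 n m τ z) ∧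
        Summable (IndefiniteModular.hTerm m n ν τ z)) ∧
    -- the `S`-transformation, at all `z` where every function in it is defined
    (∀ z : ℂ, (∀ a b : ℤ, (m : ℂ) * z ≠ a + b * τ) →
      IndefiniteModular.G m n ν (-1 / τ) (z / τ) =
          Complex.I * (-Complex.I * τ) ^ (3 / 2 : ℂ) / (2 * m * (Real.sqrt (2 * m + 1) : ℂ)) *
            ∑ n' ∈ Finset.range M, ∑ ν' ∈ Finset.range (M + 1), ∑ l ∈ Finset.range M,
              IndefiniteModular.sTerm m n ν τ z n' ν' l ∧
      -- the sum over `ℓ ∈ ℤ/2mℤ`, for any choice `r` of representatives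
      ∀ r : ZMod M → ℤ, (∀ c : ZMod M, (r c : ZMod M) = c) →
        IndefiniteModular.G m n ν (-1 / τ) (z / τ) =
          Complex.I * (-Complex.I * τ) ^ (3 / 2 : ℂ) / (2 * m * (Real.sqrt (2 * m + 1) : ℂ)) *
            ∑ n' ∈ Finset.range M, ∑ ν' ∈ Finset.range (M + 1), ∑ c : ZMod M,
              IndefiniteModular.sTerm m n ν τ z n' ν' (r c)) ∧
    -- the `T`-transformation for integral `m`
    ((∃ k : ℕ, m = k) → ∀ z : ℂ, (∀ a b : ℤ, (m : ℂ) * z ≠ a + 2 * m * b * τ) →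
      IndefiniteModular.G m n ν (τ + 1) z =
        Complex.exp (Real.pi * Complex.I / (2 * (m + 1 / 2)) * ((ν : ℂ) + 1 / 2) ^ 2) *
          IndefiniteModular.G m n ν τ z) := by
  subst hm
  have hM : 0 < M := Nat.pos_of_ne_zero (NeZero.ne M)
  have hMr : (0 : ℝ) < (M : ℝ) / 2 := by
    have : (0 : ℝ) < M := by exact_mod_cast hM
    positivity
  have hnm : (n : ℝ) ≤ 2 * ((M : ℝ) / 2) := by
    rw [mul_div_cancel₀ _ (by norm_num)]
    exact_mod_cast hn.le
  have hcast : (((M : ℝ) / 2 : ℝ) : ℂ) = (M : ℂ) / 2 := by push_cast; rfl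
  have h2M : 2 * ((M : ℂ) / 2) = M := by ring
  have h2M' : 2 * ((M : ℝ) / 2) = M := by ring
  refine ⟨⟨?_, ?_, ?_, fun z _ => ⟨?_, ?_⟩⟩, fun z hz => ?_, ?_⟩
  · exact summable_subtype_iff_indicator.mpr (IndefiniteModular.summable_indicator_gTerm hτ hMr hnm
      ν IndefiniteModular.conePos_bound)
  · exact summable_subtype_iff_indicator.mpr (IndefiniteModular.summable_indicator_gTerm hτ hMr hnm
      ν IndefiniteModular.coneNeg_bound)
  · exact IndefiniteModular.summable_thetaTerm (by simp) _ (by positivity) hτ 0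
  · exact IndefiniteModular.summable_thetaTerm norm_one _ hMr hτ z
  · exact IndefiniteModular.summable_hTerm hτ hn ν z
  · rw [hcast] at hz
    rw [hcast, h2M, h2M']
    have hS := IndefiniteModular.G_S hn ν hτ hz
    refine ⟨?_, hS⟩
    -- The representatives in [0, M) give the sum over 0 ≤ ℓ < 2m.
    rw [hS (fun c => (c.val : ℤ)) fun c => by simp]
    congr 1
    refine Finset.sum_congr rfl fun n' _ => Finset.sum_congr rfl fun ν' _ => ?_
    exact IndefiniteModular.sum_zmod_val M
      fun l => IndefiniteModular.sTerm ((M : ℝ) / 2) n ν τ z n' ν' l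
  · rintro ⟨k, hk⟩ z hz
    have hMk : (M : ℝ) = k + k := by linarith
    have hMeven : Even M := ⟨k, by exact_mod_cast hMk⟩
    rw [hcast, h2M] at hz
    rw [IndefiniteModular.G_T hn hMeven ν hτ hz, hcast,
      show 2 * ((M : ℂ) / 2 + 1 / 2) = M + 1 by ring]
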